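/- An election is given by a finite candidate set $C$ and a list of votes, each consisting of a voter name and a preference order, i.e., a total order over $C$. Under Plurality, each candidate scores one point for each vote that ranks it first, and all candidates of $C$ with maximum score are winners (there may be several). In a weighted election each vote has a nonnegative integer weight, and a vote of weight $w$ counts as $w$ copies of that vote. An online bribery setting (OBS) is a tuple $(C,(V_{<u},u,V_{u<}),\sigma,d,k)$, where $C$ is a finite set of candidates; $V_{<u}$ is the list, in voting order, of the voters who voted before $u$, each with a name, the vote that was cast, and a bit telling whether the voter was bribed; $u$ is the current voter, with a name and the vote that $u$ casts unless bribed; $V_{u<}$ is the list, in voting order, of the names of the voters who vote after $u$; $\sigma$ is a total order over $C$ (the briber's preference); $d\in C$; and $k$ is a nonnegative integer. In the priced case every listed voter also comes with a price, and in the weighted case with a weight (nonnegative integers); in the unpriced (unweighted) case no prices (weights) are given. All numbers are written in binary. A set of bribes is legal if, in the unpriced case, the number of bribed voters is at most $k$ and, in the priced case, the sum of their prices is at most $k$; voters of $V_{<u}$ that were bribed count. The process runs as follows. The briber first decides whether to bribe $u$ and, if so, which vote over $C$ replaces $u$'s vote. Then, for each voter of $V_{u<}$ in order, an arbitrary vote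 over $C$ of that voter is revealed, whereupon the briber decides whether to bribe this voter and, if so, which vote over $C$ replaces it. Every decision may depend only on what has been revealed so far and must keep the set of bribes legal. Let $W\subseteq C$ be the set of Plurality winners (of the weighted election, in the weighted case) for the final list of votes. In the constructive version the briber's goal is $W\cap\{c: c\ge_\sigma d\}\ne\emptyset$; in the destructive version it is $W\cap\{c: d\ge_\sigma c\}=\emptyset$. The online bribery problem for Plurality, in each of these cases, is to decide, given an OBS, whether the bribes made before $u$ are legal and the briber has a legal decision regarding $u$ such that, whatever votes the later voters are revealed to have, the goal can be reached by legal later decisions. Theorem. For Plurality, the following six online bribery problems are in $\mathrm{P}$: unpriced unweighted, unpriced weighted, and priced unweighted, each in its constructive and in its destructive version. -/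

import Mathlib

/-! ### The class P -/

open Classical in
/-- A language over the alphabet `Γ` is in P if its characteristic function is computed by a
deterministic (multi-stack) Turing machine in time polynomial in the length of the input string.
Every string over `Γ` is an input, so malformed strings have to be rejected by the machine. -/
def InP {Γ : Type} (L : Language Γ) : Prop :=
  Nonempty (Turing.TM2ComputableInPolyTime (fun x : List Γ => x) Computability.encodeBool
    (fun x : List Γ => decide (x ∈ L)))

/-! ### Elections -/

namespace Election

/-- Candidates and voters are named by natural numbers (written in binary). -/
abbrev Name := ℕ

/-- A preference order is written as the list of all candidates, most preferred first. -/
abbrev Pref := List Name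

/-- `σ` is a total order over the candidates listed (without repetition) in `C`. -/
def IsPref (C : List Name) (σ : Pref) : Prop := σ.Perm C

/-- `σ.Geq a b`: the order `σ` ranks `a` at least as high as `b`. -/
def Pref.Geq (σ : Pref) (a b : Name) : Prop := σ.idxOf a ≤ σ.idxOf b

/-- An unweighted vote: a voter name and a preference order. -/
structure Vote where
  voter : Name
  order : Pref

/-- An election system maps a candidate set and a collection of votes to a set of winners. -/
structure ElectionSystem where
  winners : Finset Name → List Vote → Finset Name
  winners_subset : ∀ C V, winners C V ⊆ C

/-- The number of votes that rank `c` first. -/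
def pluralityScore (V : List Vote) (c : Name) : ℕ :=
  V.countP fun v => decide (v.order.head? = some c)

/-- Plurality: the candidates of maximum plurality score win. -/
def plurality : ElectionSystem where
  winners C V := C.filter fun c => ∀ b ∈ C, pluralityScore V b ≤ pluralityScore V c
  winners_subset _ _ := Finset.filter_subset _ _

/-- A weighted vote. -/
structure WeightedVote where
  vote : Vote
  weight : ℕ

/-- The weighted version of an election system: a vote of weight `w` counts as `w` copies of the
unweighted vote. -/
def ElectionSystem.weightedWinners (E : ElectionSystem) (C : Finset Name)
    (U : List WeightedVote) : Finset Name :=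
  E.winners C (U.flatMap fun v => List.replicate v.weight v.vote)

/-! ### Online bribery settings -/

/-- Price (or weight) data of a voter: a natural number in the priced (weighted) case, and no
data at all in the unpriced (unweighted) case. -/
def OptNat : Bool → Type
  | true => ℕ
  | false => Unit

/-- In the unpriced case each bribe counts 1 towards the limit; in the unweighted case each vote
counts once. -/
def OptNat.value : {b : Bool} → OptNat b → ℕ
  | true, n => n
  | false, _ => 1

/-- A voter after `u`: the vote is not known yet. -/
structure FutureVoter (priced weighted : Bool) where
  name : Name
  price : OptNat priced
  weight : OptNat weighted

/-- The voter `u`, with the vote that `u` casts unless bribed. -/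
structure CurrentVoter (priced weighted : Bool) extends FutureVoter priced weighted where
  vote : Pref

/-- A voter before `u`, with the vote that was cast and a bit telling whether the voter was
bribed. -/
structure PastVoter (priced weighted : Bool) extends CurrentVoter priced weighted where
  bribed : Bool

/-- An online bribery setting `(C, (V_{<u}, u, V_{u<}), σ, d, k)`. -/
structure OBS (priced weighted : Bool) where
  candidates : List Name
  past : List (PastVoter priced weighted)
  current : CurrentVoter priced weighted
  future : List (FutureVoter priced weighted)
  briber : Pref
  d : Name
  k : ℕ

/-- The candidates form a set, all votes and the briber's preference are total orders over it, and
`d` is a candidate. -/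
structure OBS.WellFormed {p w : Bool} (I : OBS p w) : Prop where
  nodup : I.candidates.Nodup
  past : ∀ v ∈ I.past, IsPref I.candidates v.vote
  current : IsPref I.candidates I.current.vote
  briber : IsPref I.candidates I.briber
  mem : I.d ∈ I.candidates

/-- The constructive and the destructive version of the problem. -/
inductive Version
  | constructive
  | destructive

/-- The briber's goal, as a property of the collection `U` of all cast votes. -/
def OBS.Goal {p w : Bool} (I : OBS p w) (E : ElectionSystem) (U : List WeightedVote) :
    Version → Prop
  | .constructive => ∃ c ∈ E.weightedWinners I.candidates.toFinset U, I.briber.Geq c I.d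
  | .destructive => ∀ c ∈ E.weightedWinners I.candidates.toFinset U, ¬ I.briber.Geq I.d c

/-- The vote that voter `v` casts with preference order `σ`. -/
def FutureVoter.cast {p w : Bool} (v : FutureVoter p w) (σ : Pref) : WeightedVote :=
  ⟨⟨v.name, σ⟩, v.weight.value⟩

/-- `Decide C k v σ spent cast next`: when `v` is about to vote `σ`, after `spent` has been used
up and the votes `cast` have been cast, the briber can leave `v` alone, or can legally bribe `v`
into some vote `τ`, such that the resulting situation satisfies `next`. -/
def Decide {p w : Bool} (C : List Name) (k : ℕ) (v : FutureVoter p w) (σ : Pref) (spent : ℕ)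
    (cast : List WeightedVote) (next : ℕ → List WeightedVote → Prop) : Prop :=
  next spent (cast ++ [v.cast σ]) ∨
    (spent + v.price.value ≤ k ∧
      ∃ τ, IsPref C τ ∧ next (spent + v.price.value) (cast ++ [v.cast τ]))

/-- The briber can enforce `goal` when the listed voters are still to vote: whatever vote the
first of them is revealed to have, the briber has a legal decision from which `goal` can
be enforced. -/
def CanForce {p w : Bool} (C : List Name) (k : ℕ) (goal : List WeightedVote → Prop) :
    List (FutureVoter p w) → ℕ → List WeightedVote → Prop
  | [], _, cast => goal cast
  | v :: rest, spent, cast =>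
      ∀ σ, IsPref C σ → Decide C k v σ spent cast (CanForce C k goal rest)

/-- What has been spent on bribes before `u` (in the unpriced case: the number of bribes). -/
def OBS.spent {p w : Bool} (I : OBS p w) : ℕ :=
  (I.past.map fun v => if v.bribed then v.price.value else 0).sum

/-- The votes cast before `u`. -/
def OBS.castVotes {p w : Bool} (I : OBS p w) : List WeightedVote :=
  I.past.map fun v => v.cast v.vote

/-- The question asked about an online bribery setting: the limit `k` has not been violated so far
and the briber has a legal decision regarding `u` from which the goal can be enforced. -/
def OBS.Succeeds {p w : Bool} (I : OBS p w) (E : ElectionSystem) (version : Version) : Prop :=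
  I.spent ≤ I.k ∧
    Decide I.candidates I.k I.current.toFutureVoter I.current.vote I.spent I.castVotes
      (CanForce I.candidates I.k (fun U => I.Goal E U version) I.future)

/-! ### Instances as strings -/

open Computability (Γ')

/-- A number: its binary digits, followed by a comma. -/
def encNat (n : ℕ) : List Γ' := (Computability.encodeNat n).map Γ'.bit ++ [Γ'.comma]

/-- A list: each entry is preceded by `bra`, and the end is marked by `ket`. -/
def encList {α : Type} (e : α → List Γ') : List α → List Γ'
  | [] => [Γ'.ket]
  | a :: l => Γ'.bra :: (e a ++ encList e l)

/-- Prices and weights are in binary, and omitted in the unpriced or unweighted case. -/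
def encOptNat : {b : Bool} → OptNat b → List Γ'
  | true, n => encNat n
  | false, _ => []

def FutureVoter.enc {p w : Bool} (v : FutureVoter p w) : List Γ' :=
  encNat v.name ++ (encOptNat v.price ++ encOptNat v.weight)

def CurrentVoter.enc {p w : Bool} (v : CurrentVoter p w) : List Γ' :=
  v.toFutureVoter.enc ++ encList encNat v.vote

def PastVoter.enc {p w : Bool} (v : PastVoter p w) : List Γ' :=
  v.toCurrentVoter.enc ++ [Γ'.bit v.bribed]

/-- The string that represents an online bribery setting. -/
def OBS.enc {p w : Bool} (I : OBS p w) : List Γ' :=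
  encList encNat I.candidates ++ (encList PastVoter.enc I.past ++ (I.current.enc ++
    (encList FutureVoter.enc I.future ++ (encList encNat I.briber ++ (encNat I.d ++ encNat I.k)))))

/-- The online bribery problem for the election system `E`: the set of all strings that represent a
(well-formed) online bribery setting with a positive answer. -/
def onlineBribery (E : ElectionSystem) (version : Version) (priced weighted : Bool) :
    Language Γ' :=
  {x | ∃ I : OBS priced weighted, I.WellFormed ∧ I.Succeeds E version ∧ I.enc = x}

/-! ### Different settings are represented by different strings -/

/-- A self-delimiting code. -/
def PrefixCode {α : Type} (e : α → List Γ') : Prop :=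
  ∀ a b s t, e a ++ s = e b ++ t → a = b ∧ s = t

theorem map_bit_comma (l m : List Bool) (s t : List Γ')
    (h : l.map Γ'.bit ++ Γ'.comma :: s = m.map Γ'.bit ++ Γ'.comma :: t) : l = m ∧ s = t := by
  induction l generalizing m with
  | nil => cases m <;> simp_all
  | cons a l ih =>
    cases m with
    | nil => simp_all
    | cons b m =>
      simp only [List.map_cons, List.cons_append, List.cons.injEq, Γ'.bit.injEq] at h
      obtain ⟨h1, h2⟩ := ih m h.2
      exact ⟨by rw [h.1, h1], h2⟩

theorem prefixCode_encNat : PrefixCode encNat := by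
  intro a b s t h
  simp only [encNat, List.append_assoc, List.singleton_append] at h
  obtain ⟨h1, h2⟩ := map_bit_comma _ _ _ _ h
  exact ⟨Computability.encodingNatBool.encode_injective h1, h2⟩

theorem prefixCode_encOptNat {b : Bool} : PrefixCode (encOptNat (b := b)) := by
  cases b with
  | true => exact prefixCode_encNat
  | false => exact fun a b s t h => ⟨rfl, h⟩

theorem prefixCode_encList {α : Type} {e : α → List Γ'} (he : PrefixCode e) :
    PrefixCode (encList e) := by
  intro l
  induction l with
  | nil =>
    intro m s t h
    cases m <;> simp_all [encList]
  | cons a l ih =>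
    intro m s t h
    cases m with
    | nil => simp_all [encList]
    | cons b m =>
      simp only [encList, List.cons_append, List.append_assoc, List.cons.injEq, true_and] at h
      obtain ⟨h1, h2⟩ := he _ _ _ _ h
      obtain ⟨h3, h4⟩ := ih _ _ _ h2
      exact ⟨by rw [h1, h3], h4⟩

theorem prefixCode_future {p w : Bool} :
    PrefixCode (FutureVoter.enc (p := p) (w := w)) := by
  rintro ⟨n, x, y⟩ ⟨n', x', y'⟩ s t h
  simp only [FutureVoter.enc, List.append_assoc] at h
  obtain ⟨rfl, h1⟩ := prefixCode_encNat _ _ _ _ h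
  obtain ⟨rfl, h2⟩ := prefixCode_encOptNat _ _ _ _ h1
  obtain ⟨rfl, h3⟩ := prefixCode_encOptNat _ _ _ _ h2
  exact ⟨rfl, h3⟩

theorem prefixCode_current {p w : Bool} :
    PrefixCode (CurrentVoter.enc (p := p) (w := w)) := by
  rintro ⟨v, x⟩ ⟨v', x'⟩ s t h
  simp only [CurrentVoter.enc, List.append_assoc] at h
  obtain ⟨rfl, h1⟩ := prefixCode_future _ _ _ _ h
  obtain ⟨rfl, h2⟩ := prefixCode_encList prefixCode_encNat _ _ _ _ h1
  exact ⟨rfl, h2⟩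

theorem prefixCode_past {p w : Bool} :
    PrefixCode (PastVoter.enc (p := p) (w := w)) := by
  rintro ⟨v, x⟩ ⟨v', x'⟩ s t h
  simp only [PastVoter.enc, List.append_assoc] at h
  obtain ⟨rfl, h1⟩ := prefixCode_current _ _ _ _ h
  simpa using h1

theorem OBS.enc_injective {p w : Bool} :
    Function.Injective (OBS.enc (p := p) (w := w)) := by
  rintro ⟨c, pa, u, f, b, d, k⟩ ⟨c', pa', u', f', b', d', k'⟩ h
  simp only [OBS.enc] at h
  obtain ⟨rfl, h1⟩ := prefixCode_encList prefixCode_encNat _ _ _ _ h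
  obtain ⟨rfl, h2⟩ := prefixCode_encList prefixCode_past _ _ _ _ h1
  obtain ⟨rfl, h3⟩ := prefixCode_current _ _ _ _ h2
  obtain ⟨rfl, h4⟩ := prefixCode_encList prefixCode_future _ _ _ _ h3
  obtain ⟨rfl, h5⟩ := prefixCode_encList prefixCode_encNat _ _ _ _ h4
  obtain ⟨rfl, h6⟩ := prefixCode_encNat _ _ _ _ h5
  obtain ⟨rfl, -⟩ := prefixCode_encNat k k' [] [] (by simpa using h6)
  rfl

end Election

/-! Plurality sees only first choices, and the later votes are revealed by an adversary. Call a
candidate good if it is at least as good as `d` for the briber (constructive case) or strictly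
better than `d` (destructive case). The goal says that some good candidate has at least the score of
every bad one, or strictly more in the destructive case (`goal_iff`).

The worst that a later voter can do is to vote for a bad candidate of maximum score, and the best
use of a bribe is a vote for one fixed good candidate. So adaptive play gains nothing. Let `m` be
the required lead, 0 or 1. The briber can force the goal iff there are an affordable set of later
voters, of total weight `X`, the others having weight `Y`, and a good `g` such that the score of `g`
plus `X` is at least the score of `b` plus `Y + m` for every bad `b` (`canForce_iff`). As `X + Y` is
fixed, `X` has to be maximized within the budget. This is a knapsack problem, easy here because all
prices or all weights are equal to 1: the voters can then be sorted so that each is at most as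
expensive and at least as heavy as the next ones, and an exchange argument shows that the greedy
choice is optimal (`Sel.exchange`, `Sel.le_greedy`). For the current voter it suffices to try no
bribe and a bribe to each possible first choice (`succeeds_iff`).

The other half is the running time on a Turing machine. Structured programs over stacks of bits are
compiled to instructions with jumps, and these are simulated step by step (`reach_compile`,
`inP_of_run`). Data are coded as binary trees in Polish notation, and `Poly` is the class of
functions computed in time polynomial in the length of the code. It is closed under composition,
pairing, conditionals and folds whose accumulators stay small (`Poly.comp`, `Poly.pair`, `Poly.ite`,
`Poly.foldl`); list functions, binary arithmetic, parsing, sorting and the greedy choice are built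
from these. Malformed strings are rejected by parsing, encoding the result again and comparing
(`inP_of_poly_obs`). -/

/-! ### Structured programs over stacks of bits -/

namespace PolyTime

open Function
open Computability (Γ')

/-- The contents of infinitely many stacks of bits. -/
abbrev Stacks := ℕ → List Bool

/-- Structured programs over stacks. `pop k p₀ p₁ pₑ` pops a bit from stack `k` and branches on it
(`pₑ` if there is none); `loop k p₀ p₁` pops bits from stack `k` and runs `p₀` or `p₁` after each of
them, until the stack is found empty. -/
inductive Prog
  | skip
  | push (k : ℕ) (b : Bool)
  | seq (p q : Prog)
  | pop (k : ℕ) (p₀ p₁ pₑ : Prog)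
  | loop (k : ℕ) (p₀ p₁ : Prog)

/-- `Run p s t s'`: the program `p`, started with the stacks `s`, ends after `t` steps with the
stacks `s'`. -/
inductive Run : Prog → Stacks → ℕ → Stacks → Prop
  | skip {s} : Run .skip s 0 s
  | push {k b s} : Run (.push k b) s 1 (update s k (b :: s k))
  | seq {p q s t s' t' s''} : Run p s t s' → Run q s' t' s'' → Run (.seq p q) s (t + t') s''
  | pop_nil {k p₀ p₁ pₑ s t s'} : s k = [] → Run pₑ s t s' → Run (.pop k p₀ p₁ pₑ) s (t + 2) s'
  | pop_false {k p₀ p₁ pₑ s t s' l} : s k = false :: l → Run p₀ (update s k l) t s' →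
      Run (.pop k p₀ p₁ pₑ) s (t + 2) s'
  | pop_true {k p₀ p₁ pₑ s t s' l} : s k = true :: l → Run p₁ (update s k l) t s' →
      Run (.pop k p₀ p₁ pₑ) s (t + 2) s'
  | loop_nil {k p₀ p₁ s} : s k = [] → Run (.loop k p₀ p₁) s 1 s
  | loop_false {k p₀ p₁ s t s' t' s'' l} : s k = false :: l → Run p₀ (update s k l) t s' →
      Run (.loop k p₀ p₁) s' t' s'' → Run (.loop k p₀ p₁) s (t + 2 + t') s''
  | loop_true {k p₀ p₁ s t s' t' s'' l} : s k = true :: l → Run p₁ (update s k l) t s' →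
      Run (.loop k p₀ p₁) s' t' s'' → Run (.loop k p₀ p₁) s (t + 2 + t') s''

/-- No stack grows by more than one symbol per step. -/
theorem Run.length_le {p s t s'} (h : Run p s t s') (j : ℕ) :
    (s' j).length ≤ (s j).length + t := by
  have upd : ∀ {s : Stacks} {k : ℕ} {b : Bool} {l : List Bool}, s k = b :: l →
      (update s k l j).length ≤ (s j).length := by
    intro s k b l h
    by_cases hj : j = k
    · subst hj; simp [h]
    · simp [hj]
  induction h with
  | skip => simp
  | @push k b s =>
    by_cases hj : j = k
    · subst hj; simp
    · simp [hj]
  | seq _ _ ih ih' => omega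
  | pop_nil _ _ ih => omega
  | pop_false h _ ih => have := upd h; omega
  | pop_true h _ ih => have := upd h; omega
  | loop_nil => omega
  | loop_false h _ _ ih ih' => have := upd h; omega
  | loop_true h _ _ ih ih' => have := upd h; omega

/-- A bound on the stacks that a program uses. -/
def Prog.maxReg : Prog → ℕ
  | .skip => 0
  | .push k _ => k
  | .seq p q => max p.maxReg q.maxReg
  | .pop k p₀ p₁ pₑ => max k (max p₀.maxReg (max p₁.maxReg pₑ.maxReg))
  | .loop k p₀ p₁ => max k (max p₀.maxReg p₁.maxReg)

/-- The program `p` on the stacks from `n` on. -/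
def Prog.shift (n : ℕ) : Prog → Prog
  | .skip => .skip
  | .push k b => .push (n + k) b
  | .seq p q => .seq (p.shift n) (q.shift n)
  | .pop k p₀ p₁ pₑ => .pop (n + k) (p₀.shift n) (p₁.shift n) (pₑ.shift n)
  | .loop k p₀ p₁ => .loop (n + k) (p₀.shift n) (p₁.shift n)

/-- The first stacks are given by a list, followed by the stacks `s`. -/
def glue : List (List Bool) → Stacks → Stacks
  | [], s => s
  | x :: u, s => fun i => Nat.casesOn i x (glue u s)

theorem glue_add (u : List (List Bool)) (s : Stacks) (k : ℕ) : glue u s (u.length + k) = s k := by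
  induction u with
  | nil => simp [glue]
  | cons x u ih =>
    rw [List.length_cons, Nat.add_right_comm]
    exact ih

theorem glue_update (u : List (List Bool)) (s : Stacks) (k : ℕ) (l : List Bool) :
    glue u (update s k l) = update (glue u s) (u.length + k) l := by
  induction u with
  | nil => simp [glue]
  | cons x u ih =>
    funext i
    cases i with
    | zero => rw [update_of_ne (by simp; omega)]; rfl
    | succ i =>
      change glue u (update s k l) i = _
      rw [ih, List.length_cons, Nat.add_right_comm]
      by_cases hi : i = u.length + k
      · subst hi; simp
      · rw [update_of_ne hi, update_of_ne (by omega)]; rfl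

/-- The shifted program never touches the stacks in `u`. Hence a program can be reused as a
subroutine while other data are kept below it. -/
theorem Run.shift {p s t s'} (h : Run p s t s') (u : List (List Bool)) :
    Run (p.shift u.length) (glue u s) t (glue u s') := by
  induction h with
  | skip => exact .skip
  | @push k b s =>
    rw [glue_update]
    have := Run.push (k := u.length + k) (b := b) (s := glue u s)
    rwa [glue_add] at this
  | seq _ _ ih ih' => exact .seq ih ih'
  | pop_nil h _ ih => exact .pop_nil (by rw [glue_add, h]) ih
  | pop_false h _ ih => exact .pop_false (by rw [glue_add, h]) (by rwa [← glue_update])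
  | pop_true h _ ih => exact .pop_true (by rw [glue_add, h]) (by rwa [← glue_update])
  | loop_nil h => exact .loop_nil (by rw [glue_add, h])
  | loop_false h _ _ ih ih' => exact .loop_false (by rw [glue_add, h]) (by rwa [← glue_update]) ih'
  | loop_true h _ _ ih ih' => exact .loop_true (by rw [glue_add, h]) (by rwa [← glue_update]) ih'

/-! ### Compilation to instructions with jumps -/

inductive Instr
  | push (k : ℕ) (b : Bool)
  | pop (k : ℕ) (a₀ a₁ aₑ : ℕ)
  | jump (a : ℕ)

/-- The number of instructions of a compiled program. -/
def Prog.len : Prog → ℕ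
  | .skip => 0
  | .push _ _ => 1
  | .seq p q => p.len + q.len
  | .pop _ p₀ p₁ pₑ => p₀.len + p₁.len + pₑ.len + 4
  | .loop _ p₀ p₁ => p₀.len + p₁.len + 3

/-- The instructions for `p`, to be placed at address `n`. -/
def Prog.compile : Prog → ℕ → List Instr
  | .skip, _ => []
  | .push k b, _ => [.push k b]
  | .seq p q, n => p.compile n ++ q.compile (n + p.len)
  | .pop k p₀ p₁ pₑ, n =>
    .pop k (n + 1) (n + 1 + p₀.len + 1) (n + 1 + p₀.len + 1 + p₁.len + 1) ::
      (p₀.compile (n + 1) ++ .jump (n + (Prog.pop k p₀ p₁ pₑ).len) ::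
      (p₁.compile (n + 1 + p₀.len + 1) ++ .jump (n + (Prog.pop k p₀ p₁ pₑ).len) ::
      (pₑ.compile (n + 1 + p₀.len + 1 + p₁.len + 1) ++ [.jump (n + (Prog.pop k p₀ p₁ pₑ).len)])))
  | .loop k p₀ p₁, n =>
    .pop k (n + 1) (n + 1 + p₀.len + 1) (n + (Prog.loop k p₀ p₁).len) ::
      (p₀.compile (n + 1) ++ .jump n :: (p₁.compile (n + 1 + p₀.len + 1) ++ [.jump n]))

theorem Prog.length_compile (p : Prog) (n : ℕ) : (p.compile n).length = p.len := by
  induction p generalizing n with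
  | skip => rfl
  | push => rfl
  | seq p q ih ih' => simp [compile, len, ih, ih']
  | pop k p₀ p₁ pₑ h₀ h₁ hₑ => simp [compile, len, h₀, h₁, hₑ]; omega
  | loop k p₀ p₁ h₀ h₁ => simp [compile, len, h₀, h₁]; omega

/-- The instructions `L` are found in `C` from address `n` on. -/
def CodeAt (C : List Instr) : ℕ → List Instr → Prop
  | _, [] => True
  | n, a :: L => C[n]? = some a ∧ CodeAt C (n + 1) L

theorem codeAt_append {C : List Instr} {n : ℕ} {L M : List Instr} :
    CodeAt C n (L ++ M) ↔ CodeAt C n L ∧ CodeAt C (n + L.length) M := by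
  induction L generalizing n with
  | nil => simp [CodeAt]
  | cons a L ih =>
    simp only [List.cons_append, CodeAt, ih, List.length_cons, and_assoc]
    rw [show n + 1 + L.length = n + (L.length + 1) by omega]

theorem codeAt_self (u C : List Instr) : CodeAt (u ++ C) u.length C := by
  induction C generalizing u with
  | nil => trivial
  | cons a C ih =>
    refine ⟨by simp, ?_⟩
    have := ih (u ++ [a])
    simpa using this

/-! ### Simulation by a Turing machine -/

/-- The alphabets of the stacks of the machine: an input stack, and stacks of bits. -/
abbrev Alph (N : ℕ) : Option (Fin (N + 1)) → Type
  | none => Γ'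
  | some _ => Bool

/-- The stack of the machine that holds stack `k` of the program. -/
abbrev reg (N k : ℕ) : Option (Fin (N + 1)) := some (Fin.ofNat (N + 1) k)

/-- The label of the machine for the address `a`. -/
def lbl (C : List Instr) (a : ℕ) : Option (Fin (C.length + 1)) :=
  some ⟨min a C.length, by omega⟩

abbrev MStmt (C : List Instr) (N : ℕ) :=
  Turing.TM2.Stmt (Alph N) (Option (Fin (C.length + 1))) (Option Γ')

/-- Three bits that represent a symbol of the input alphabet. -/
def symBits : Γ' → Bool × Bool × Bool
  | .blank => (false, false, false)
  | .bit b => (true, false, b)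
  | .bra => (true, true, false)
  | .ket => (true, true, true)
  | .comma => (false, true, false)

/-- Continue at address `a`, with the variable of the machine reset. -/
def gotoStmt (C : List Instr) (N a : ℕ) : MStmt C N :=
  .load (fun _ => none) (.goto fun _ => lbl C a)

/-- The statement for one instruction. -/
def instrStmt (C : List Instr) (N n : ℕ) : Option Instr → MStmt C N
  | none => .halt
  | some (.push k b) => .push (reg N k) (fun _ => b) (gotoStmt C N (n + 1))
  | some (.jump a) => gotoStmt C N a
  | some (.pop k a₀ a₁ aₑ) =>
    .pop (reg N k) (fun _ o => o.map Γ'.bit)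
      (.branch (fun v => v == none) (gotoStmt C N aₑ)
        (.branch (fun v => v == some (Γ'.bit true)) (gotoStmt C N a₁) (gotoStmt C N a₀)))

/-- The statement that moves the input, in bits, to stack 0. -/
def inputStmt (C : List Instr) (N : ℕ) : MStmt C N :=
  .pop none (fun _ (o : Option Γ') => o)
    (.branch (fun v => v == none) (gotoStmt C N 0)
      (.push (reg N 0) (fun v => (symBits (v.getD .blank)).2.2)
        (.push (reg N 0) (fun v => (symBits (v.getD .blank)).2.1)
          (.push (reg N 0) (fun v => (symBits (v.getD .blank)).1)
            (.load (fun _ => none) (.goto fun _ => none))))))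

instance (N : ℕ) : Fintype (Alph N none) := inferInstanceAs (Fintype Γ')

/-- The machine that reads its input into stack 0 and then executes the instructions `C`. -/
abbrev machine (C : List Instr) (N : ℕ) : Turing.FinTM2 where
  K := Option (Fin (N + 1))
  k₀ := none
  k₁ := some 0
  Γ := Alph N
  Λ := Option (Fin (C.length + 1))
  main := none
  σ := Option Γ'
  initialState := none
  m
    | none => inputStmt C N
    | some n => instrStmt C N n C[n.val]?

/-- The stacks of the machine. -/
def mstk (N : ℕ) (x : List Γ') (s : Stacks) : ∀ k, List (Alph N k)
  | none => x
  | some i => s i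

/-- The configuration of the machine at address `n`. -/
def conf (C : List Instr) (N n : ℕ) (s : Stacks) : (machine C N).Cfg :=
  ⟨some (lbl C n), none, mstk N [] s⟩

/-- `Reach f a t b`: from `a`, `t` steps of `f` lead to `b`. -/
def Reach {σ : Type} (f : σ → Option σ) (a : σ) (t : ℕ) (b : σ) : Prop :=
  (flip bind f)^[t] (some a) = some b

theorem Reach.trans {σ : Type} {f : σ → Option σ} {a b c : σ} {t u : ℕ} (h : Reach f a t b)
    (h' : Reach f b u c) : Reach f a (t + u) c := by
  unfold Reach at *
  rw [Nat.add_comm, iterate_add_apply, h, h']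

theorem Reach.single {σ : Type} {f : σ → Option σ} {a b : σ} (h : f a = some b) :
    Reach f a 1 b := h

/-- The bound `k ≤ N` keeps `Fin.ofNat` from wrapping around, which would identify different stacks.
-/
theorem mstk_reg {N k : ℕ} (hk : k ≤ N) (x : List Γ') (s : Stacks) :
    mstk N x s (reg N k) = s k := by
  change s (Fin.ofNat (N + 1) k) = s k
  rw [Fin.val_ofNat, Nat.mod_eq_of_lt (by omega)]

theorem update_mstk {N k : ℕ} (hk : k ≤ N) (x : List Γ') (s : Stacks) (l : List Bool) :
    update (mstk N x s) (reg N k) l = mstk N x (update s k l) := by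
  have hr : (Fin.ofNat (N + 1) k).val = k := by
    rw [Fin.val_ofNat, Nat.mod_eq_of_lt (by omega)]
  funext i
  cases i with
  | none => rw [update_of_ne (by simp)]; rfl
  | some i =>
    by_cases hi : i.val = k
    · have : some i = reg N k := congrArg some (Fin.ext (by rw [hr, hi]))
      rw [this, update_self, mstk_reg hk, update_self]
    · rw [update_of_ne]
      · change s i = update s k l i
        rw [update_of_ne hi]
      · intro h
        exact hi (by rw [Option.some.inj h, hr])

variable {C : List Instr} {N : ℕ}

theorem step_conf {n : ℕ} {a : Instr} (s : Stacks) (ha : C[n]? = some a) :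
    (machine C N).step (conf C N n s) =
      some (Turing.TM2.stepAux (instrStmt C N n (some a)) none (mstk N [] s)) := by
  have hn : n < C.length := by
    by_contra h
    rw [List.getElem?_eq_none (by omega)] at ha
    cases ha
  change some (Turing.TM2.stepAux (instrStmt C N (min n C.length) C[min n C.length]?) _ _) = _
  rw [min_eq_left hn.le, ha]

theorem step_jump {n a : ℕ} (s : Stacks) (ha : C[n]? = some (.jump a)) :
    Reach (machine C N).step (conf C N n s) 1 (conf C N a s) := by
  exact .single (step_conf s ha)

theorem step_push {n k : ℕ} {b : Bool} (s : Stacks) (hk : k ≤ N) (ha : C[n]? = some (.push k b)) :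
    Reach (machine C N).step (conf C N n s) 1 (conf C N (n + 1) (update s k (b :: s k))) := by
  refine .single ((step_conf s ha).trans (congrArg some ?_))
  change (⟨some (lbl C (n + 1)), none, update (mstk N [] s) (reg N k) (b :: mstk N [] s (reg N k))⟩ :
    (machine C N).Cfg) = _
  rw [mstk_reg hk, update_mstk hk]; rfl

theorem step_pop {n k a₀ a₁ aₑ : ℕ} (s : Stacks) (hk : k ≤ N)
    (ha : C[n]? = some (.pop k a₀ a₁ aₑ)) :
    Reach (machine C N).step (conf C N n s) 1
      (conf C N (match (s k).head? with | none => aₑ | some false => a₀ | some true => a₁)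
        (update s k (s k).tail)) := by
  refine .single ((step_conf s ha).trans (congrArg some ?_))
  have h1 : (mstk N [] s (reg N k) : List Bool).head? = (s k).head? := by rw [mstk_reg hk]
  change Turing.TM2.stepAux (.branch (fun v => v == none) (gotoStmt C N aₑ)
        (.branch (fun v => v == some (Γ'.bit true)) (gotoStmt C N a₁) (gotoStmt C N a₀)))
        (Option.map Γ'.bit (mstk N [] s (reg N k) : List Bool).head?)
        (update (mstk N [] s) (reg N k) (mstk N [] s (reg N k) : List Bool).tail) = _
  rw [h1, mstk_reg hk, update_mstk hk]
  rcases (s k).head? with _ | _ | _ <;> rfl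

/-- The step counts of `Run` are chosen to agree exactly with the machine: the `+ 2` for a branch or
a loop iteration pays for the pop and for the closing jump. Sequencing is free, since consecutive
code needs no jump. -/
theorem reach_compile {p s t s'} (h : Run p s t s') (hN : p.maxReg ≤ N) {n : ℕ}
    (hC : CodeAt C n (p.compile n)) :
    Reach (machine C N).step (conf C N n s) t (conf C N (n + p.len) s') := by
  induction h generalizing n with
  | skip => rfl
  | push => exact step_push _ hN hC.1
  | @seq p q s t s' t' s'' _ _ ih ih' =>
    simp only [Prog.compile, codeAt_append, Prog.length_compile] at hC
    simp only [Prog.maxReg, max_le_iff] at hN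
    have := (ih hN.1 hC.1).trans (ih' hN.2 hC.2)
    rwa [Nat.add_assoc] at this
  | @pop_nil k p₀ p₁ pₑ s t s' h _ ih =>
    simp only [Prog.compile, codeAt_append, Prog.length_compile, CodeAt] at hC
    simp only [Prog.maxReg, max_le_iff] at hN
    have h1 := step_pop s hN.1 hC.1
    -- Popping an empty stack writes back the same empty stack.
    rw [h, List.tail_nil, ← h, update_eq_self] at h1
    rw [h] at h1
    have := (h1.trans (ih hN.2.2.2 hC.2.2.2.2.2.1)).trans (step_jump _ hC.2.2.2.2.2.2.1)
    rwa [show 1 + t + 1 = t + 2 by omega] at this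
  | @pop_false k p₀ p₁ pₑ s t s' l h _ ih =>
    simp only [Prog.compile, codeAt_append, Prog.length_compile, CodeAt] at hC
    simp only [Prog.maxReg, max_le_iff] at hN
    have h1 := step_pop s hN.1 hC.1
    rw [h] at h1
    have := (h1.trans (ih hN.2.1 hC.2.1)).trans (step_jump _ hC.2.2.1)
    rwa [show 1 + t + 1 = t + 2 by omega] at this
  | @pop_true k p₀ p₁ pₑ s t s' l h _ ih =>
    simp only [Prog.compile, codeAt_append, Prog.length_compile, CodeAt] at hC
    simp only [Prog.maxReg, max_le_iff] at hN
    have h1 := step_pop s hN.1 hC.1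
    rw [h] at h1
    have := (h1.trans (ih hN.2.2.1 hC.2.2.2.1)).trans (step_jump _ hC.2.2.2.2.1)
    rwa [show 1 + t + 1 = t + 2 by omega] at this
  | @loop_nil k p₀ p₁ s h =>
    simp only [Prog.compile, codeAt_append, Prog.length_compile, CodeAt] at hC
    simp only [Prog.maxReg, max_le_iff] at hN
    have h1 := step_pop s hN.1 hC.1
    rw [h, List.tail_nil, ← h, update_eq_self] at h1
    rwa [h] at h1
  | @loop_false k p₀ p₁ s t s' t' s'' l h _ _ ih ih' =>
    have hC' := hC
    have hN' := hN
    simp only [Prog.compile, codeAt_append, Prog.length_compile, CodeAt] at hC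
    -- The unsplit hypotheses are kept because the rest of the loop is a run of the same code at the
    -- same address.
    simp only [Prog.maxReg, max_le_iff] at hN
    have h1 := step_pop s hN.1 hC.1
    rw [h] at h1
    have := ((h1.trans (ih hN.2.1 hC.2.1)).trans (step_jump _ hC.2.2.1)).trans (ih' hN' hC')
    rwa [show 1 + t + 1 = t + 2 by omega] at this
  | @loop_true k p₀ p₁ s t s' t' s'' l h _ _ ih ih' =>
    have hC' := hC
    have hN' := hN
    simp only [Prog.compile, codeAt_append, Prog.length_compile, CodeAt] at hC
    simp only [Prog.maxReg, max_le_iff] at hN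
    have h1 := step_pop s hN.1 hC.1
    rw [h] at h1
    have := ((h1.trans (ih hN.2.2 hC.2.2.2.1)).trans (step_jump _ hC.2.2.2.2.1)).trans (ih' hN' hC')
    rwa [show 1 + t + 1 = t + 2 by omega] at this

/-- The input in bits, as it is found on stack 0 after reading. -/
def rawBits (x : List Γ') : List Bool :=
  x.reverse.flatMap fun a => [(symBits a).1, (symBits a).2.1, (symBits a).2.2]

/-- The symbol read first ends up deepest in stack 0, which is why `rawBits` reverses the input.
Each symbol takes one step, and one more step detects the end of the input. -/
theorem reach_input (x : List Γ') (l : List Bool) :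
    Reach (machine C N).step ⟨some none, none, mstk N x (glue [l] fun _ => [])⟩ (x.length + 1)
      (conf C N 0 (glue [rawBits x ++ l] fun _ => [])) := by
  have upd : ∀ (x : List Γ') (s : Stacks),
      update (mstk N x s) none (mstk N x s none : List Γ').tail = mstk N x.tail s := by
    intro x s
    funext i
    cases i with
    | none => rw [update_self]; rfl
    | some i => rw [update_of_ne (by simp)]; rfl
  have h0 : ∀ l l' : List Bool, update (glue [l] fun _ => []) 0 l' = glue [l'] fun _ => [] := by
    intro l l'
    funext i
    cases i with
    | zero => rw [update_self]; rfl
    | succ i => rw [update_of_ne (by simp)]; rfl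
  induction x generalizing l with
  | nil =>
    refine .single (congrArg some ?_)
    change Turing.TM2.stepAux (gotoStmt C N 0) none (update (mstk N [] (glue [l] fun _ => []))
      none (mstk N [] (glue [l] fun _ => []) none : List Γ').tail) = _
    rw [upd]; rfl
  | cons a x ih =>
    have h1 : Reach (machine C N).step ⟨some none, none, mstk N (a :: x) (glue [l] fun _ => [])⟩ 1
      ⟨some none, none, mstk N x (glue [(symBits a).1 :: (symBits a).2.1 :: (symBits a).2.2 :: l]
        fun _ => [])⟩ := by
      refine .single (congrArg some ?_)
      change Turing.TM2.stepAux (.push (reg N 0) (fun v => (symBits (v.getD .blank)).2.2)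
        (.push (reg N 0) (fun v => (symBits (v.getD .blank)).2.1)
          (.push (reg N 0) (fun v => (symBits (v.getD .blank)).1)
            (.load (fun _ => none) (.goto fun _ => none))))) (some a)
            (update (mstk N (a :: x) (glue [l] fun _ => [])) none
              (mstk N (a :: x) (glue [l] fun _ => []) none : List Γ').tail) = _
      rw [upd]
      simp only [Turing.TM2.stepAux]
      simp only [mstk_reg (Nat.zero_le N), update_mstk (Nat.zero_le N), h0]
      rfl
    have := h1.trans (ih _)
    simpa [rawBits, Nat.add_comm] using this

/-- A language is in P if its characteristic function is computed by a program in polynomial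
time. -/
theorem inP_of_run {L : Language Γ'} (f : List Γ' → Bool) (hf : ∀ x, f x = true ↔ x ∈ L) (p : Prog)
    (q : Polynomial ℕ) (h : ∀ x, ∃ t ≤ q.eval x.length,
      Run p (glue [rawBits x] fun _ => []) t (glue [[f x]] fun _ => [])) : InP L := by
  classical
  refine ⟨⟨⟨machine (p.compile 0) p.maxReg, Equiv.refl Γ', Equiv.refl Bool⟩,
    -- Reading the input takes `x.length + 1` steps, and one further step halts after the program.
    q + Polynomial.X + 2, fun x => ⟨⟨Classical.choose (h x) + x.length + 2, ?_⟩, ?_⟩⟩⟩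
  · obtain ⟨ht, hr⟩ := Classical.choose_spec (h x)
    generalize Classical.choose (h x) = t at ht hr
    have h1 := reach_input (C := p.compile 0) (N := p.maxReg) x []
    have h2 := reach_compile (C := p.compile 0) hr le_rfl (codeAt_self [] _)
    rw [List.append_nil] at h1
    have h3 : Reach (machine (p.compile 0) p.maxReg).step
        (conf (p.compile 0) p.maxReg (0 + p.len) (glue [[f x]] fun _ => [])) 1
        ⟨none, none, mstk p.maxReg [] (glue [[f x]] fun _ => [])⟩ := by
      refine .single ?_
      change some (Turing.TM2.stepAux (instrStmt (p.compile 0) p.maxReg _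
        (p.compile 0)[min (0 + p.len) (p.compile 0).length]?) _ _) = _
      -- The end address of the program lies just past its code, where no instruction is found and
      -- the machine halts.
      have hnone : (p.compile 0)[min (0 + p.len) (p.compile 0).length]? = none := by
        simp [Prog.length_compile]
      rw [hnone]
      rfl
    have h4 := (h1.trans h2).trans h3
    rw [show x.length + 1 + t + 1 = t + x.length + 2 by omega] at h4
    have hin : Turing.initList (machine (p.compile 0) p.maxReg) x =
        ⟨some none, none, mstk p.maxReg x (glue [[]] fun _ => [])⟩ := by
      unfold Turing.initList
      congr 1
      funext k
      rcases k with _ | ⟨_ | i, hi⟩ <;> rfl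
    have hout : Turing.haltList (machine (p.compile 0) p.maxReg) [f x] =
        ⟨none, none, mstk p.maxReg [] (glue [[f x]] fun _ => [])⟩ := by
      unfold Turing.haltList
      congr 1
      funext k
      rcases k with _ | ⟨_ | i, hi⟩ <;> rfl
    have hd : decide (x ∈ L) = f x := by
      rw [Bool.eq_iff_iff, decide_eq_true_iff, hf]
    have hmap : ∀ {α : Type} (l : List α), List.map (Equiv.refl α).invFun l = l :=
      fun l => List.map_id l
    rw [hmap]
    erw [hin]
    refine Eq.trans h4 ?_
    simp only [Option.map_some, Computability.encodeBool]
    rw [hmap, ← hout, hd]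
    rfl
  · obtain ⟨ht, -⟩ := Classical.choose_spec (h x)
    simp only [Polynomial.eval_add, Polynomial.eval_X, Polynomial.eval_ofNat]
    omega

end PolyTime

/-! ### Programs that work on codes of binary trees -/

namespace PolyTime

open Function
open Computability (Γ')

/-- `p` runs from `s` to `s'` in at most `n` steps. -/
def RunsIn (p : Prog) (s : Stacks) (n : ℕ) (s' : Stacks) : Prop := ∃ t ≤ n, Run p s t s'

theorem RunsIn.mono {p s n m s'} (h : RunsIn p s n s') (hm : n ≤ m) : RunsIn p s m s' :=
  let ⟨t, ht, h⟩ := h; ⟨t, ht.trans hm, h⟩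

theorem RunsIn.seq {p q s n s' m s''} (h : RunsIn p s n s') (h' : RunsIn q s' m s'') :
    RunsIn (.seq p q) s (n + m) s'' :=
  let ⟨t, ht, h⟩ := h; let ⟨t', ht', h'⟩ := h'; ⟨t + t', by omega, .seq h h'⟩

theorem RunsIn.skip {s} : RunsIn .skip s 0 s := ⟨0, le_rfl, .skip⟩

/-- Finitely many stacks, the others being empty. -/
def st (L : List (List Bool)) : Stacks := glue L fun _ => []

theorem st_get (L : List (List Bool)) (k : ℕ) (hk : k < L.length) : st L k = L[k] := by
  induction L generalizing k with
  | nil => simp at hk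
  | cons x L ih =>
    cases k with
    | zero => rfl
    | succ k => exact ih k (by simpa using hk)

theorem update_st (L : List (List Bool)) (k : ℕ) (hk : k < L.length) (l : List Bool) :
    update (st L) k l = st (L.set k l) := by
  induction L generalizing k with
  | nil => simp at hk
  | cons x L ih =>
    funext i
    cases k with
    | zero => cases i <;> rfl
    | succ k =>
      have := congrFun (ih k (by simpa using hk))
      cases i with
      | zero => rfl
      | succ i =>
        refine Eq.trans ?_ (this i)
        by_cases hi : i = k
        · subst hi; simp
        · rw [update_of_ne hi, update_of_ne (by omega)]; rfl

theorem glue_glue (u v : List (List Bool)) (s : Stacks) : glue u (glue v s) = glue (u ++ v) s := by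
  induction u with
  | nil => rfl
  | cons x u ih => simp only [List.cons_append, glue, ih]

theorem st_replicate (m : ℕ) : st (List.replicate m []) = st [] := by
  induction m with
  | zero => rfl
  | succ m ih =>
    funext i
    cases i with
    | zero => rfl
    | succ i => exact congrFun ih i

/-- Unlisted stacks are empty, so empty entries may be added freely to make scratch stacks
available. -/
theorem st_pad (u : List (List Bool)) (m : ℕ) : st (u ++ List.replicate m []) = st u := by
  unfold st
  rw [← glue_glue]
  have := st_replicate m
  unfold st at this
  rw [this, glue_glue, List.append_nil]

/-- A program for one stack may be used above other stacks. -/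
theorem RunsIn.at {p x n y} (h : RunsIn p (st [x]) n (st [y])) (u : List (List Bool)) (m : ℕ) :
    RunsIn (p.shift u.length) (st (u ++ x :: List.replicate m [])) n
      (st (u ++ y :: List.replicate m [])) := by
  obtain ⟨t, ht, h⟩ := h
  refine ⟨t, ht, ?_⟩
  have := h.shift u
  unfold st at this
  rw [glue_glue, glue_glue] at this
  have key : ∀ z : List Bool, st (u ++ z :: List.replicate m []) = glue (u ++ [z]) fun _ => [] := by
    intro z
    rw [show u ++ z :: List.replicate m [] = (u ++ [z]) ++ List.replicate m [] by simp, st_pad]; rfl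
  rwa [key, key]

theorem run_push (L : List (List Bool)) (k : ℕ) (b : Bool) (hk : k < L.length) :
    RunsIn (.push k b) (st L) 1 (st (L.set k (b :: L[k]))) := by
  rw [← update_st _ _ hk, ← st_get]; exact ⟨1, le_rfl, .push⟩

theorem RunsIn.pop_false {L : List (List Bool)} {k : ℕ} {p₀ p₁ pₑ n s' l} (hk : k < L.length)
    (h : L[k] = false :: l) (h' : RunsIn p₀ (st (L.set k l)) n s') :
    RunsIn (.pop k p₀ p₁ pₑ) (st L) (n + 2) s' :=
  let ⟨t, ht, h'⟩ := h'
  ⟨t + 2, by omega, .pop_false (by rw [st_get _ _ hk, h]) (by rwa [update_st _ _ hk])⟩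

theorem RunsIn.pop_true {L : List (List Bool)} {k : ℕ} {p₀ p₁ pₑ n s' l} (hk : k < L.length)
    (h : L[k] = true :: l) (h' : RunsIn p₁ (st (L.set k l)) n s') :
    RunsIn (.pop k p₀ p₁ pₑ) (st L) (n + 2) s' :=
  let ⟨t, ht, h'⟩ := h'
  ⟨t + 2, by omega, .pop_true (by rw [st_get _ _ hk, h]) (by rwa [update_st _ _ hk])⟩

theorem RunsIn.pop {L : List (List Bool)} {k : ℕ} {p₀ p₁ pₑ n s' b l} (hk : k < L.length)
    (h : L[k] = b :: l) (h' : RunsIn (if b then p₁ else p₀) (st (L.set k l)) n s') :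
    RunsIn (.pop k p₀ p₁ pₑ) (st L) (n + 2) s' := by
  cases b
  · exact .pop_false hk h h'
  · exact .pop_true hk h h'

theorem RunsIn.loop_nil {L : List (List Bool)} {k : ℕ} {p₀ p₁} (hk : k < L.length)
    (h : L[k] = []) : RunsIn (.loop k p₀ p₁) (st L) 1 (st L) :=
  ⟨1, le_rfl, .loop_nil (by rw [st_get _ _ hk, h])⟩

theorem RunsIn.loop_cons {L : List (List Bool)} {k : ℕ} {p₀ p₁ n s' m s'' b l} (hk : k < L.length)
    (h : L[k] = b :: l) (h' : RunsIn (if b then p₁ else p₀) (st (L.set k l)) n s')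
    (h'' : RunsIn (.loop k p₀ p₁) s' m s'') :
    RunsIn (.loop k p₀ p₁) (st L) (n + 2 + m) s'' := by
  obtain ⟨t, ht, h'⟩ := h'
  obtain ⟨t', ht', h''⟩ := h''
  refine ⟨t + 2 + t', by omega, ?_⟩
  cases b
  · exact .loop_false (by rw [st_get _ _ hk, h]) (by rwa [update_st _ _ hk]) h''
  · exact .loop_true (by rw [st_get _ _ hk, h]) (by rwa [update_st _ _ hk]) h''

/-! ### Basic operations on whole stacks. -/

/-- Move stack `k`, in reverse, onto stack `j`. -/
def move (k j : ℕ) : Prog := .loop k (.push j false) (.push j true)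

/-- Move stack `m`, in reverse, onto the stacks `k` and `j`. -/
def dup (m k j : ℕ) : Prog :=
  .loop m (.seq (.push k false) (.push j false)) (.seq (.push k true) (.push j true))

/-- Clear stack `k`. -/
def clear (k : ℕ) : Prog := .loop k .skip .skip

/-- Push the list `l` onto stack `k`. -/
def pushList (k : ℕ) : List Bool → Prog
  | [] => .skip
  | b :: l => .seq (pushList k l) (.push k b)

theorem run_move (L : List (List Bool)) (k j : ℕ) (hk : k < L.length) (hj : j < L.length)
    (hkj : k ≠ j) : RunsIn (move k j) (st L) (3 * L[k].length + 1)
      (st ((L.set j (L[k].reverse ++ L[j])).set k [])) := by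
  generalize hl : L[k] = l
  induction l generalizing L with
  | nil =>
    rw [show ((L.set j (([] : List Bool).reverse ++ L[j])).set k []) = L by
        refine List.ext_getElem (by simp) fun i h _ => ?_
        simp only [List.getElem_set]
        split_ifs <;> simp_all]
    exact .loop_nil hk hl
  | cons b l ih =>
    have h1 : RunsIn (if b then Prog.push j true else .push j false) (st (L.set k l)) 1
        (st ((L.set k l).set j (b :: L[j]))) := by
      have := run_push (L.set k l) j b (by simpa using hj)
      rw [List.getElem_set_ne hkj] at this
      cases b <;> exact this
    have h2 := ih ((L.set k l).set j (b :: L[j])) (by simpa using hk) (by simpa using hj)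
      (by rw [List.getElem_set_ne (Ne.symm hkj), List.getElem_set_self])
    have e : (((((L.set k l).set j (b :: L[j])).set j (l.reverse ++ (b :: L[j])))).set k []) =
        (L.set j ((b :: l).reverse ++ L[j])).set k [] := by
      refine List.ext_getElem (by simp) fun i h _ => ?_
      simp only [List.getElem_set]
      split_ifs <;> simp
    rw [← e]
    refine (RunsIn.loop_cons hk hl h1 ?_).mono (show 1 + 2 + (3 * l.length + 1) ≤ _ by simp; omega)
    rw [List.getElem_set_self] at h2
    exact h2

theorem run_dup (L : List (List Bool)) (m k j : ℕ) (hm : m < L.length) (hk : k < L.length)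
    (hj : j < L.length) (hkm : m ≠ k) (hjm : m ≠ j) (hkj : k ≠ j) :
    RunsIn (dup m k j) (st L) (4 * L[m].length + 1)
      (st (((L.set k (L[m].reverse ++ L[k])).set j (L[m].reverse ++ L[j])).set m [])) := by
  generalize hl : L[m] = l
  induction l generalizing L with
  | nil =>
    rw [show (((L.set k (([] : List Bool).reverse ++ L[k])).set j
      (([] : List Bool).reverse ++ L[j])).set m []) = L by
        refine List.ext_getElem (by simp) fun i h _ => ?_
        simp only [List.getElem_set]
        split_ifs <;> simp_all]
    exact .loop_nil hm hl
  | cons b l ih =>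
    have h1 : RunsIn (if b then Prog.seq (.push k true) (.push j true) else
        .seq (.push k false) (.push j false)) (st (L.set m l)) 2
        (st (((L.set m l).set k (b :: L[k])).set j (b :: L[j]))) := by
      have h3 := run_push (L.set m l) k b (by simpa using hk)
      have h4 := run_push ((L.set m l).set k (b :: L[k])) j b (by simpa using hj)
      rw [List.getElem_set_ne hkm] at h3
      rw [List.getElem_set_ne hkj, List.getElem_set_ne hjm] at h4
      cases b <;> exact h3.seq h4
    have h2 := ih (((L.set m l).set k (b :: L[k])).set j (b :: L[j])) (by simpa using hm)
      (by simpa using hk) (by simpa using hj)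
      (by rw [List.getElem_set_ne (Ne.symm hjm), List.getElem_set_ne (Ne.symm hkm),
            List.getElem_set_self])
    have e : ((((((L.set m l).set k (b :: L[k])).set j (b :: L[j])).set k
        (l.reverse ++ (b :: L[k]))).set j (l.reverse ++ (b :: L[j]))).set m []) =
        ((L.set k ((b :: l).reverse ++ L[k])).set j ((b :: l).reverse ++ L[j])).set m [] := by
      refine List.ext_getElem (by simp) fun i h _ => ?_
      simp only [List.getElem_set]
      split_ifs <;> simp
    rw [← e]
    refine (RunsIn.loop_cons hm hl h1 ?_).mono (show 2 + 2 + (4 * l.length + 1) ≤ _ by simp; omega)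
    have e1 : (((L.set m l).set k (b :: L[k])).set j (b :: L[j]))[k]'(by simpa using hk) =
        b :: L[k] := by simp [Ne.symm hkj]
    have e2 : (((L.set m l).set k (b :: L[k])).set j (b :: L[j]))[j]'(by simpa using hj) =
        b :: L[j] := by simp
    rw [e1, e2] at h2
    exact h2

theorem run_clear (L : List (List Bool)) (k : ℕ) (hk : k < L.length) :
    RunsIn (clear k) (st L) (2 * L[k].length + 1) (st (L.set k [])) := by
  generalize hl : L[k] = l
  induction l generalizing L with
  | nil =>
    rw [show L.set k [] = L by simp [← hl]]
    exact .loop_nil hk hl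
  | cons b l ih =>
    have h2 := ih (L.set k l) (by simpa using hk) (by rw [List.getElem_set_self])
    rw [List.set_set] at h2
    refine (RunsIn.loop_cons hk hl (n := 0) ?_ h2).mono (by simp; omega)
    cases b <;> exact .skip

theorem run_pushList (L : List (List Bool)) (k : ℕ) (l : List Bool) (hk : k < L.length) :
    RunsIn (pushList k l) (st L) l.length (st (L.set k (l ++ L[k]))) := by
  induction l with
  | nil => rw [List.nil_append, List.set_getElem_self]; exact .skip
  | cons b l ih =>
    have := run_push (L.set k (l ++ L[k])) k b (by simpa using hk)
    rw [List.getElem_set_self, List.set_set] at this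
    exact ih.seq this

/-! ### Binary trees and cutting the code of one tree off a stack. -/

/-- Binary trees, the data type of our programs. -/
inductive D
  | leaf
  | node (l r : D)

namespace D

/-- The code of a tree, in Polish notation. -/
def code : D → List Bool
  | leaf => [false]
  | node l r => true :: (l.code ++ r.code)

/-- The length of the code. -/
def size (d : D) : ℕ := d.code.length

theorem size_node (l r : D) : (node l r).size = l.size + r.size + 1 := by simp [size, code]

theorem size_pos (d : D) : 0 < d.size := by cases d <;> simp [size, code]

/-- The left subtree. -/
def left : D → D
  | leaf => leaf
  | node l _ => l

/-- The right subtree. -/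
def right : D → D
  | leaf => leaf
  | node _ r => r

end D

/-- Move one symbol of a tree in Polish notation. -/
def splitBody (k j c : ℕ) : Prog :=
  .pop k (.push j false) (.seq (.push j true) (.seq (.push c true) (.push c true))) .skip

/-- Move a tree from stack `k` in reverse to stack `j`, counting open subtrees on stack `c`. -/
def split (k j c : ℕ) : Prog :=
  .seq (.push c true) (.loop c (splitBody k j c) (splitBody k j c))

/-- Stack `c` holds in unary the number of subtrees still to be read: a leaf closes one, and a node
replaces one by two. The run after `d` has been moved enters as the hypothesis `h`, because the same
loop goes on reading whatever follows `d`. This makes induction on the tree possible. -/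
theorem run_splitLoop (d : D) (L : List (List Bool)) (k j c : ℕ) (hk : k < L.length)
    (hj : j < L.length) (hc : c < L.length) (hkj : k ≠ j) (hkc : k ≠ c) (hjc : j ≠ c)
    (r u : List Bool) (hr : L[k] = d.code ++ r) (hu : L[c] = true :: u) (n : ℕ) (s : Stacks)
    (h : RunsIn (.loop c (splitBody k j c) (splitBody k j c))
      (st (((L.set k r).set j (d.code.reverse ++ L[j])).set c u)) n s) :
    RunsIn (.loop c (splitBody k j c) (splitBody k j c)) (st L) (7 * d.size + n) s := by
  induction d generalizing L r u n with
  | leaf =>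
    refine (RunsIn.loop_cons hc hu (n := 3) ?_ h).mono (by simp [D.size, D.code])
    refine RunsIn.pop (b := false) (l := r) (by simpa using hk) ?_ ?_
    · rw [List.getElem_set_ne (Ne.symm hkc), hr]; rfl
    · have := run_push ((L.set c u).set k r) j false (by simpa using hj)
      rw [List.getElem_set_ne hkj, List.getElem_set_ne (Ne.symm hjc)] at this
      rw [if_neg (by simp)]
      convert this using 2
      refine List.ext_getElem (by simp) fun i h _ => ?_
      simp only [List.getElem_set]
      split_ifs <;> simp_all [D.code]
  | node a b iha ihb =>
    -- The runs are assembled from the end: the right subtree continues with `h`, and the left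
    -- subtree continues with the right one.
    have h1 : RunsIn (.loop c (splitBody k j c) (splitBody k j c))
        (st (((L.set k (b.code ++ r)).set j (a.code.reverse ++ (true :: L[j]))).set c (true :: u)))
        (7 * b.size + n) s := by
      refine ihb _ (by simpa using hk) (by simpa using hj) (by simpa using hc) r u ?_ ?_ n ?_
      · rw [List.getElem_set_ne (Ne.symm hkc), List.getElem_set_ne (Ne.symm hkj),
          List.getElem_set_self]
      · rw [List.getElem_set_self]
      · convert h using 2
        refine List.ext_getElem (by simp) fun i h _ => ?_
        simp only [List.getElem_set]
        split_ifs <;> simp_all [D.code]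
    have h2 : RunsIn (.loop c (splitBody k j c) (splitBody k j c))
        (st (((L.set k (a.code ++ (b.code ++ r))).set j (true :: L[j])).set c (true :: true :: u)))
        (7 * a.size + (7 * b.size + n)) s := by
      refine iha _ (by simpa using hk) (by simpa using hj) (by simpa using hc) (b.code ++ r)
        (true :: u) ?_ ?_ _ ?_
      · rw [List.getElem_set_ne (Ne.symm hkc), List.getElem_set_ne (Ne.symm hkj),
          List.getElem_set_self]
      · rw [List.getElem_set_self]
      · convert h1 using 2
        refine List.ext_getElem (by simp) fun i h _ => ?_
        simp only [List.getElem_set]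
        split_ifs <;> simp_all
    -- The factor 7 comes from node symbols: 2 steps for the loop, 2 for the pop and 3 pushes.
    refine (RunsIn.loop_cons hc hu (n := 5) ?_ h2).mono (by simp [D.size, D.code]; omega)
    refine RunsIn.pop (b := true) (l := a.code ++ (b.code ++ r)) (by simpa using hk) ?_ ?_
    · rw [List.getElem_set_ne (Ne.symm hkc), hr]; simp [D.code]
    · have h3 := run_push ((L.set c u).set k (a.code ++ (b.code ++ r))) j true (by simpa using hj)
      have h4 := run_push (((L.set c u).set k (a.code ++ (b.code ++ r))).set j (true :: L[j])) c true
        (by simpa using hc)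
      have h5 := run_push ((((L.set c u).set k (a.code ++ (b.code ++ r))).set j (true :: L[j])).set c
        (true :: u)) c true (by simpa using hc)
      rw [List.getElem_set_ne hkj, List.getElem_set_ne (Ne.symm hjc)] at h3
      rw [List.getElem_set_ne hjc, List.getElem_set_ne hkc, List.getElem_set_self] at h4
      rw [List.getElem_set_self] at h5
      rw [if_pos rfl]
      refine (h3.seq (h4.seq (m := 1) ?_)).mono (by omega)
      convert h5 using 2
      refine List.ext_getElem (by simp) fun i h _ => ?_
      simp only [List.getElem_set]
      split_ifs <;> simp_all

theorem run_split (d : D) (L : List (List Bool)) (k j c : ℕ) (hk : k < L.length)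
    (hj : j < L.length) (hc : c < L.length) (hkj : k ≠ j) (hkc : k ≠ c) (hjc : j ≠ c)
    (r : List Bool) (hr : L[k] = d.code ++ r) (hu : L[c] = []) :
    RunsIn (split k j c) (st L) (7 * d.size + 2) (st ((L.set k r).set j (d.code.reverse ++ L[j]))) := by
  have h1 := run_push L c true hc
  rw [hu] at h1
  refine (h1.seq (m := 7 * d.size + 1) ?_).mono (by omega)
  refine run_splitLoop d _ k j c (by simpa using hk) (by simpa using hj) (by simpa using hc) hkj hkc
    hjc r [] (by rw [List.getElem_set_ne (Ne.symm hkc), hr]) (by rw [List.getElem_set_self]) 1 _ ?_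
  rw [List.getElem_set_ne (Ne.symm hjc)]
  have e : ((((L.set c [true]).set k r).set j (d.code.reverse ++ L[j])).set c []) =
      (L.set k r).set j (d.code.reverse ++ L[j]) := by
    refine List.ext_getElem (by simp) fun i h _ => ?_
    simp only [List.getElem_set]
    split_ifs <;> simp_all
  rw [e]
  refine .loop_nil (by simpa using hc) ?_
  rw [List.getElem_set_ne hjc, List.getElem_set_ne hkc, hu]

end PolyTime

/-! ### Functions computable in polynomial time -/

namespace PolyTime

open Function
open Computability (Γ')

/-- A type whose elements are represented by binary trees. -/
class Enc (α : Type) where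
  toD : α → D

open Enc (toD)

/-- The size of the representation. -/
def size {α : Type} [Enc α] (a : α) : ℕ := (toD a).size

/-- The code of the representation. -/
def cod {α : Type} [Enc α] (a : α) : List Bool := (toD a).code

theorem length_cod {α : Type} [Enc α] (a : α) : (cod a).length = size a := rfl

/-- `f` is computed by a program in polynomial time. -/
@[fun_prop]
def Poly {α β : Type} [Enc α] [Enc β] (f : α → β) : Prop :=
  ∃ (p : Prog) (q : Polynomial ℕ), ∀ a, RunsIn p (st [cod a]) (q.eval (size a)) (st [cod (f a)])

theorem eval_mono (q : Polynomial ℕ) {m n : ℕ} (h : m ≤ n) : q.eval m ≤ q.eval n := by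
  induction q using Polynomial.induction_on' with
  | add p q hp hq => simpa using add_le_add hp hq
  | monomial k a => simpa using Nat.mul_le_mul_left a (Nat.pow_le_pow_left h k)

/-- A stack gains at most one symbol per step, so the running time also bounds the output.
Composition of polynomial-time functions depends on this. -/
theorem RunsIn.length_le {p L n L'} (h : RunsIn p (st [L]) n (st [L'])) :
    L'.length ≤ L.length + n := by
  obtain ⟨t, ht, h⟩ := h
  have : L'.length ≤ L.length + t := h.length_le 0
  omega

variable {α β γ δ : Type} [Enc α] [Enc β] [Enc γ] [Enc δ]

theorem Poly.size_le {f : α → β} (hf : Poly f) :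
    ∃ q : Polynomial ℕ, ∀ a, size (f a) ≤ q.eval (size a) := by
  obtain ⟨p, q, h⟩ := hf
  refine ⟨q + Polynomial.X, fun a => ?_⟩
  have := (h a).length_le
  simp only [length_cod] at this
  simp; omega

@[fun_prop]
theorem Poly.id : Poly fun a : α => a := ⟨.skip, 0, fun _ => .mono .skip (Nat.zero_le _)⟩

@[fun_prop]
theorem Poly.comp {g : β → γ} {f : α → β} (hg : Poly g) (hf : Poly f) : Poly fun a => g (f a) := by
  obtain ⟨pf, qf, hf⟩ := hf
  obtain ⟨pg, qg, hg⟩ := hg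
  refine ⟨.seq pf pg, qf + qg.comp (qf + Polynomial.X), fun a => ((hf a).seq (hg (f a))).mono ?_⟩
  have h1 := (hf a).length_le
  simp only [length_cod] at h1
  have h2 := eval_mono qg (show size (f a) ≤ qf.eval (size a) + size a by omega)
  simp only [Polynomial.eval_add, Polynomial.eval_comp, Polynomial.eval_X]
  omega

@[fun_prop]
theorem Poly.const (b : β) : Poly fun _ : α => b := by
  refine ⟨.seq (clear 0) (pushList 0 (cod b)), 2 * Polynomial.X + Polynomial.C (1 + size b), fun a => ?_⟩
  have h1 := run_clear [cod a] 0 (by simp)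
  have h2 := run_pushList [[]] 0 (cod b) (by simp)
  simp only [List.set_cons_zero, List.getElem_cons_zero, length_cod, List.append_nil] at h1 h2
  refine (h1.seq h2).mono ?_
  simp
  omega

instance : Enc D := ⟨fun d => d⟩

/-- Both values have codes of length 5, beginning with `true`; the second symbol is the value
itself. Sizes of booleans are therefore constant, and a program can branch after two pops. -/
instance : Enc Bool := ⟨fun b => bif b then .node (.node .leaf .leaf) .leaf else
  .node .leaf (.node .leaf .leaf)⟩

instance : Enc (α × β) := ⟨fun p => .node (toD p.1) (toD p.2)⟩

instance : Enc Unit := ⟨fun _ => .leaf⟩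

/-- Lists are represented by nested pairs. -/
def listToD : List α → D
  | [] => .leaf
  | a :: l => .node (toD a) (listToD l)

instance : Enc (List α) := ⟨listToD⟩

instance : Enc (Option α) := ⟨fun o => o.elim .leaf fun a => .node (toD a) .leaf⟩

theorem cod_pair (a : α) (b : β) : cod (a, b) = true :: (cod a ++ cod b) := rfl

theorem cod_cons (a : α) (l : List α) : cod (a :: l) = true :: (cod a ++ cod l) := rfl

theorem size_pair (a : α) (b : β) : size (a, b) = size a + size b + 1 := D.size_node _ _

theorem size_nil : size ([] : List α) = 1 := rfl

theorem size_cons (a : α) (l : List α) : size (a :: l) = size a + size l + 1 := D.size_node _ _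

theorem size_pos (a : α) : 0 < size a := D.size_pos _

theorem size_bool (b : Bool) : size b = 5 := by cases b <;> rfl

/-- A function may be computed on representations. -/
theorem Poly.of_toD {f : α → β} (F : D → D) (hF : Poly F) (h : ∀ a, F (toD a) = toD (f a)) :
    Poly f := by
  obtain ⟨p, q, hp⟩ := hF
  refine ⟨p, q, fun a => ?_⟩
  have := hp (toD a)
  rw [h] at this
  exact this

@[fun_prop]
theorem Poly.pair {f : α → β} {g : α → γ} (hf : Poly f) (hg : Poly g) :
    Poly fun a => (f a, g a) := by
  obtain ⟨pf, qf, hf⟩ := hf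
  obtain ⟨pg, qg, hg⟩ := hg
  -- A subroutine needs empty stacks above its argument. So `f` runs on a copy above the saved
  -- input, the result is then moved below that input, and `g` runs on top. Since `move` reverses,
  -- every transfer goes through an auxiliary stack.
  refine ⟨.seq (move 0 2) <| .seq (dup 2 0 1) <| .seq (pf.shift 1) <| .seq (move 1 2) <|
    .seq (move 0 1) <| .seq (move 2 0) <| .seq (move 1 2) <| .seq (pg.shift 2) <|
    .seq (move 2 3) <| .seq (move 0 1) <| .seq (move 3 0) <| .seq (move 1 0) (.push 0 true),
    31 * Polynomial.X + 13 * qf + 7 * qg + 13, fun x => ?_⟩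
  have hf' := (hf x).length_le
  have hg' := (hg x).length_le
  set a := cod x
  set b := cod (f x)
  set c := cod (g x)
  have h1 := run_move [a, [], [], []] 0 2 (by simp) (by simp) (by simp)
  have h2 := run_dup [[], [], a.reverse, []] 2 0 1 (by simp) (by simp) (by simp) (by simp)
    (by simp) (by simp)
  have h3 := (hf x).at [a] 2
  have h4 := run_move [a, b, [], []] 1 2 (by simp) (by simp) (by simp)
  have h5 := run_move [a, [], b.reverse, []] 0 1 (by simp) (by simp) (by simp)
  have h6 := run_move [[], a.reverse, b.reverse, []] 2 0 (by simp) (by simp) (by simp)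
  have h7 := run_move [b, a.reverse, [], []] 1 2 (by simp) (by simp) (by simp)
  have h8 := (hg x).at [b, []] 1
  have h9 := run_move [b, [], c, []] 2 3 (by simp) (by simp) (by simp)
  have h10 := run_move [b, [], [], c.reverse] 0 1 (by simp) (by simp) (by simp)
  have h11 := run_move [[], b.reverse, [], c.reverse] 3 0 (by simp) (by simp) (by simp)
  have h12 := run_move [c, b.reverse, [], []] 1 0 (by simp) (by simp) (by simp)
  have h13 := run_push [b ++ c, [], [], []] 0 true (by simp)
  simp at h1 h2 h3 h4 h5 h6 h7 h8 h9 h10 h11 h12 h13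
  have key := (h1.seq <| h2.seq <| h3.seq <| h4.seq <| h5.seq <| h6.seq <| h7.seq <| h8.seq <|
    h9.seq <| h10.seq <| h11.seq <| h12.seq h13)
  rw [show st [a] = st [a, [], [], []] from (st_pad [a] 3).symm, cod_pair,
    show st [true :: (b ++ c)] = st [true :: (b ++ c), [], [], []] from (st_pad _ 3).symm]
  refine key.mono ?_
  simp only [Polynomial.eval_add, Polynomial.eval_mul, Polynomial.eval_X, Polynomial.eval_ofNat]
  have : a.length = size x := rfl
  omega

theorem Poly.left : Poly D.left := by
  refine ⟨.pop 0 (.push 0 false) (.seq (split 0 1 2) <| .seq (clear 0) (move 1 0)) .skip,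
    12 * Polynomial.X + 6, fun d => ?_⟩
  have h1 := run_push [[], [], []] 0 false (by simp)
  rw [show st [cod d] = st [cod d, [], []] from (st_pad _ 2).symm,
    show st [cod d.left] = st [cod d.left, [], []] from (st_pad _ 2).symm]
  cases d with
  | leaf => exact (RunsIn.pop_false (by simp) (l := []) rfl h1).mono (by simp)
  | node a b =>
    have h2 := run_split a [a.code ++ b.code, [], []] 0 1 2 (by simp) (by simp) (by simp) (by simp)
      (by simp) (by simp) b.code rfl rfl
    have h3 := run_clear [b.code, a.code.reverse, []] 0 (by simp)
    have h4 := run_move [[], a.code.reverse, []] 1 0 (by simp) (by simp) (by simp)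
    simp at h2 h3 h4
    refine (RunsIn.pop_true (by simp) (l := a.code ++ b.code) rfl
      (h2.seq (h3.seq h4))).mono ?_
    simp [size, toD, D.size, D.code]
    omega

theorem Poly.right : Poly D.right := by
  refine ⟨.pop 0 (.push 0 false) (.seq (split 0 1 2) (clear 1)) .skip,
    12 * Polynomial.X + 6, fun d => ?_⟩
  have h1 := run_push [[], [], []] 0 false (by simp)
  rw [show st [cod d] = st [cod d, [], []] from (st_pad _ 2).symm,
    show st [cod d.right] = st [cod d.right, [], []] from (st_pad _ 2).symm]
  cases d with
  | leaf => exact (RunsIn.pop_false (by simp) (l := []) rfl h1).mono (by simp)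
  | node a b =>
    have h2 := run_split a [a.code ++ b.code, [], []] 0 1 2 (by simp) (by simp) (by simp) (by simp)
      (by simp) (by simp) b.code rfl rfl
    have h3 := run_clear [b.code, a.code.reverse, []] 1 (by simp)
    simp at h2 h3
    refine (RunsIn.pop_true (by simp) (l := a.code ++ b.code) rfl (h2.seq h3)).mono ?_
    simp [size, toD, D.size, D.code]
    omega

@[fun_prop]
theorem Poly.fst : Poly (Prod.fst : α × β → α) := .of_toD _ .left fun _ => rfl

@[fun_prop]
theorem Poly.snd : Poly (Prod.snd : α × β → β) := .of_toD _ .right fun _ => rfl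

theorem Poly.ite {c : α → Bool} {f g : α → β} (hc : Poly c) (hf : Poly f) (hg : Poly g) :
    Poly fun a => if c a = true then f a else g a := by
  obtain ⟨pc, qc, hc⟩ := hc
  obtain ⟨pf, qf, hf⟩ := hf
  obtain ⟨pg, qg, hg⟩ := hg
  -- The condition is computed on a copy of the input. The first symbol of its code carries no
  -- information, the second selects the branch, and the remaining three are cleared.
  refine ⟨.seq (move 0 2) <| .seq (dup 2 0 1) <| .seq (pc.shift 1) <|
    .pop 1 .skip (.pop 1 (.seq (clear 1) (pg.shift 0)) (.seq (clear 1) (pf.shift 0)) .skip) .skip,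
    7 * Polynomial.X + qc + qf + qg + 13, fun x => ?_⟩
  set a := cod x
  have h1 := run_move [a, [], []] 0 2 (by simp) (by simp) (by simp)
  have h2 := run_dup [[], [], a.reverse] 2 0 1 (by simp) (by simp) (by simp) (by simp)
    (by simp) (by simp)
  have h3 := (hc x).at [a] 1
  have h4 := (hf x).at [] 2
  have h5 := (hg x).at [] 2
  simp at h1 h2 h3 h4 h5
  rw [show st [a] = st [a, [], []] from (st_pad _ 2).symm]
  have key : ∀ y, st [cod y, [], []] = st [cod (y : β)] := fun y => st_pad [cod y] 2
  have hl : a.length = size x := rfl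
  cases hx : c x with
  | false =>
    rw [hx] at h3
    simp only [hx, Bool.false_eq_true, if_false]
    rw [← key]
    have h6 := run_clear [a, [true, false, false], []] 1 (by simp)
    refine (h1.seq <| h2.seq <| h3.seq <| RunsIn.pop_true (k := 1) (by simp) rfl <|
      RunsIn.pop_false (k := 1) (by simp) rfl (h6.seq h5)).mono ?_
    simp
    omega
  | true =>
    rw [hx] at h3
    have h6 := run_clear [a, [false, false, false], []] 1 (by simp)
    simp only [hx, if_true]
    rw [← key]
    refine (h1.seq <| h2.seq <| h3.seq <| RunsIn.pop_true (k := 1) (by simp) rfl <|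
      RunsIn.pop_true (k := 1) (by simp) rfl (h6.seq h4)).mono ?_
    simp
    omega

/-! ### Folds over lists. -/

theorem size_le_of_mem {a : α} {l : List α} (h : a ∈ l) : size a ≤ size l := by
  induction l with
  | nil => simp at h
  | cons b l ih =>
    rw [size_cons]
    rcases List.mem_cons.1 h with rfl | h
    · omega
    · have := ih h; omega

theorem length_le_size (l : List α) : l.length ≤ size l := by
  induction l with
  | nil => simp
  | cons b l ih => rw [size_cons, List.length_cons]; omega

/-- One step of a fold: stacks 0 to 2 hold the rest of the list, the parameter and the
accumulator. -/
def foldBody (p : Prog) : Prog :=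
  .seq (split 0 4 3) <| .seq (move 4 3) <| .seq (move 2 4) <| .seq (move 4 3) <|
  .seq (.push 3 true) <| .seq (move 1 4) <| .seq (dup 4 1 3) <| .seq (.push 3 true) <|
  .seq (p.shift 3) <| .seq (move 3 4) (move 4 2)

/-- The code of `(x, b, c)` is assembled on stack 3, below which lie the rest of the list and a copy
of `x`, so that the program for `s` can run there. -/
theorem run_foldBody {s : α → β → γ → β} {p : Prog} {q : Polynomial ℕ}
    (hp : ∀ a : α × β × γ, RunsIn p (st [cod a]) (q.eval (size a))
      (st [cod (s a.1 a.2.1 a.2.2)])) (x : α) (b : β) (c : γ) (r : List Bool) {N : ℕ}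
    (hN : size x + size b + size c + 2 ≤ N) :
    RunsIn (foldBody p) (st [cod c ++ r, cod x, cod b, [], []]) (20 * N + 7 * q.eval N + 20)
      (st [r, cod x, cod (s x b c), [], []]) := by
  have hl := (hp (x, b, c)).length_le
  have hm := eval_mono q (show size (x, b, c) ≤ N by simp only [size_pair]; omega)
  have h1 := run_split (toD c) [cod c ++ r, cod x, cod b, [], []] 0 4 3 (by simp) (by simp) (by simp)
    (by simp) (by simp) (by simp) r rfl rfl
  change RunsIn _ _ (7 * size c + 2) (st (List.set _ 4 ((cod c).reverse ++ _))) at h1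
  have h2 := run_move [r, cod x, cod b, [], (cod c).reverse] 4 3 (by simp) (by simp) (by simp)
  have h3 := run_move [r, cod x, cod b, cod c, []] 2 4 (by simp) (by simp) (by simp)
  have h4 := run_move [r, cod x, [], cod c, (cod b).reverse] 4 3 (by simp) (by simp) (by simp)
  have h5 := run_push [r, cod x, [], cod b ++ cod c, []] 3 true (by simp)
  have h6 := run_move [r, cod x, [], cod (b, c), []] 1 4 (by simp) (by simp) (by simp)
  have h7 := run_dup [r, [], [], cod (b, c), (cod x).reverse] 4 1 3 (by simp) (by simp) (by simp)
    (by simp) (by simp) (by simp)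
  have h8 := run_push [r, cod x, [], cod x ++ cod (b, c), []] 3 true (by simp)
  have h9 := (hp (x, b, c)).at [r, cod x, []] 1
  have h10 := run_move [r, cod x, [], cod (s x b c), []] 3 4 (by simp) (by simp) (by simp)
  have h11 := run_move [r, cod x, [], [], (cod (s x b c)).reverse] 4 2 (by simp) (by simp) (by simp)
  simp [length_cod] at h1 h2 h3 h4 h5 h6 h7 h8 h9 h10 h11
  refine (h1.seq <| h2.seq <| h3.seq <| h4.seq <| h5.seq <| h6.seq <| h7.seq <| h8.seq <|
    h9.seq <| h10.seq h11).mono ?_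
  simp only [length_cod, size_pair] at *
  omega

/-- In the code of a list every entry is preceded by `true` and the end is a single `false`, so a
loop over stack 0 visits the entries: `true` starts the body, which removes the entry, and the last
`false` does nothing. The number `N` must bound the input of every step, hence the condition on all
prefixes. -/
theorem run_foldLoop {s : α → β → γ → β} {p : Prog} {q : Polynomial ℕ}
    (hp : ∀ a : α × β × γ, RunsIn p (st [cod a]) (q.eval (size a))
      (st [cod (s a.1 a.2.1 a.2.2)])) (x : α) {N : ℕ} (l : List γ) (b : β)
    (hN : ∀ l', l' <+: l → size x + size (l'.foldl (s x) b) + size l + 2 ≤ N) :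
    RunsIn (.loop 0 .skip (foldBody p)) (st [cod l, cod x, cod b, [], []])
      (l.length * (20 * N + 7 * q.eval N + 22) + 3)
      (st [[], cod x, cod (l.foldl (s x) b), [], []]) := by
  induction l generalizing b with
  | nil =>
    exact (RunsIn.loop_cons (b := false) (l := []) (by simp) rfl .skip
      (RunsIn.loop_nil (by simp) rfl)).mono (by simp)
  | cons c l ih =>
    have h1 := run_foldBody hp x b c (cod l) (N := N) (by
      have := hN [] (by simp)
      rw [size_cons] at this
      simp only [List.foldl_nil] at this
      omega)
    have h2 := ih (s x b c) (fun l' hl => by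
      have := hN (c :: l') (by simpa using hl)
      rw [size_cons] at this
      simp only [List.foldl_cons] at this
      omega)
    refine (RunsIn.loop_cons (L := [cod (c :: l), cod x, cod b, [], []]) (k := 0) (p₀ := .skip)
      (p₁ := foldBody p) (b := true) (l := cod c ++ cod l) (by simp) rfl h1 h2).mono ?_
    rw [List.length_cons, Nat.add_mul]
    omega

/-- Folds are computed in polynomial time if the accumulator stays small. -/
theorem Poly.foldl {s : α → β → γ → β} {i : α → β} {l : α → List γ}
    (hs : Poly fun a : α × β × γ => s a.1 a.2.1 a.2.2) (hi : Poly i) (hl : Poly l)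
    (B : Polynomial ℕ)
    (hB : ∀ x l', l' <+: l x → size (l'.foldl (s x) (i x)) ≤ B.eval (size x)) :
    Poly fun x => (l x).foldl (s x) (i x) := by
  obtain ⟨p₀, q₀, h₀⟩ := Poly.id.pair (hi.pair hl)
  obtain ⟨p, q, hp⟩ := hs
  obtain ⟨B', hB'⟩ := hl.size_le
  obtain ⟨B'', hB''⟩ := hi.size_le
  -- A bound for parameter, accumulator and list together, with 2 for the nodes that pair them.
  let N : Polynomial ℕ := Polynomial.X + B + B' + 2
  refine ⟨.seq p₀ <| .seq (.pop 0 .skip .skip .skip) <| .seq (split 0 4 3) <| .seq (move 4 1) <|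
    .seq (.pop 0 .skip .skip .skip) <| .seq (split 0 4 3) <| .seq (move 4 2) <|
    .seq (.loop 0 .skip (foldBody p)) <| .seq (clear 1) <| .seq (move 2 3) (move 3 0),
    q₀ + 12 * Polynomial.X + 10 * B'' + 6 * B + B' * (20 * N + 7 * q.comp N + 22) + 20,
    fun x => ?_⟩
  have hlx : (l x).length ≤ B'.eval (size x) := (length_le_size _).trans (hB' x)
  have hBl := hB x _ List.prefix_rfl
  set y := (l x).foldl (s x) (i x)
  have h1 : RunsIn (.pop 0 .skip .skip .skip) (st [cod (x, (i x, l x)), [], [], [], []]) 2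
    (st [cod x ++ cod (i x, l x), [], [], [], []]) := .pop_true (by simp) rfl .skip
  have h2 := run_split (toD x) [cod x ++ cod (i x, l x), [], [], [], []] 0 4 3 (by simp) (by simp)
    (by simp) (by simp) (by simp) (by simp) _ rfl rfl
  change RunsIn _ _ (7 * size x + 2) (st (List.set _ 4 ((cod x).reverse ++ _))) at h2
  have h3 := run_move [cod (i x, l x), [], [], [], (cod x).reverse] 4 1 (by simp) (by simp) (by simp)
  have h4 : RunsIn (.pop 0 .skip .skip .skip) (st [cod (i x, l x), cod x, [], [], []]) 2
    (st [cod (i x) ++ cod (l x), cod x, [], [], []]) := .pop_true (by simp) rfl .skip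
  have h5 := run_split (toD (i x)) [cod (i x) ++ cod (l x), cod x, [], [], []] 0 4 3 (by simp)
    (by simp) (by simp) (by simp) (by simp) (by simp) _ rfl rfl
  change RunsIn _ _ (7 * size (i x) + 2) (st (List.set _ 4 ((cod (i x)).reverse ++ _))) at h5
  have h6 := run_move [cod (l x), cod x, [], [], (cod (i x)).reverse] 4 2 (by simp) (by simp)
    (by simp)
  have h7 := run_foldLoop hp x (N := N.eval (size x)) (l x) (i x) (fun l' h' => by
    have h1 := hB' x
    have h2 := hB x l' h'
    simp only [N, Polynomial.eval_add, Polynomial.eval_X, Polynomial.eval_ofNat]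
    omega)
  have h8 := run_clear [[], cod x, cod y, [], []] 1 (by simp)
  have h9 := run_move [[], [], cod y, [], []] 2 3 (by simp) (by simp) (by simp)
  have h10 := run_move [[], [], [], (cod y).reverse, []] 3 0 (by simp) (by simp) (by simp)
  simp [length_cod] at h1 h2 h3 h4 h5 h6 h8 h9 h10
  have h0 := h₀ x
  rw [show st [cod (x, (i x, l x))] = st [cod (x, (i x, l x)), [], [], [], []] from
    (st_pad _ 4).symm] at h0
  rw [show st [cod y] = st [cod y, [], [], [], []] from (st_pad _ 4).symm]
  refine (h0.seq <| h1.seq <| h2.seq <| h3.seq <| h4.seq <| h5.seq <| h6.seq <| h7.seq <|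
    h8.seq <| h9.seq h10).mono ?_
  have h11 := Nat.mul_le_mul_right (20 * N.eval (size x) + 7 * q.eval (N.eval (size x)) + 22) hlx
  have h12 := hB'' x
  simp only [Polynomial.eval_add, Polynomial.eval_mul, Polynomial.eval_X, Polynomial.eval_ofNat,
    Polynomial.eval_comp] at *
  omega

end PolyTime

namespace PolyTime

open Function Enc
open Computability (Γ')

variable {α β γ δ : Type} [Enc α] [Enc β] [Enc γ] [Enc δ]

/-! ### Input and output -/

instance : Enc Γ' := ⟨fun a => toD (symBits a)⟩

/-- Push the code of a symbol, given by its bits, as a new entry of the list on stack 1. -/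
def symPush (b₁ b₂ b₃ : Bool) : Prog := pushList 1 (true :: cod (b₁, b₂, b₃))

/-- Read the two remaining bits of a symbol. -/
def symRead (b : Bool) : Prog :=
  .pop 0 (.pop 0 (symPush b false false) (symPush b false true) .skip)
    (.pop 0 (symPush b true false) (symPush b true true) .skip) .skip

theorem run_symRead (b₁ b₂ b₃ : Bool) (r s : List Bool) :
    RunsIn (symRead b₁) (st [b₂ :: b₃ :: r, s, []]) 22
      (st [r, true :: (cod (b₁, b₂, b₃) ++ s), []]) := by
  have h := run_pushList [r, s, []] 1 (true :: cod (b₁, b₂, b₃)) (by simp)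
  have hs : size (b₁, b₂, b₃) = 17 := by simp only [size_pair, size_bool]
  have h' : RunsIn (symPush b₁ b₂ b₃) (st [r, s, []]) 18
      (st [r, true :: (cod (b₁, b₂, b₃) ++ s), []]) :=
    h.mono (by simp only [List.length_cons, length_cod]; omega)
  cases b₂ <;> cases b₃
  · exact (RunsIn.pop_false (k := 0) (by simp) rfl
      (RunsIn.pop_false (k := 0) (by simp) rfl h')).mono (by omega)
  · exact (RunsIn.pop_false (k := 0) (by simp) rfl
      (RunsIn.pop_true (k := 0) (by simp) rfl h')).mono (by omega)
  · exact (RunsIn.pop_true (k := 0) (by simp) rfl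
      (RunsIn.pop_false (k := 0) (by simp) rfl h')).mono (by omega)
  · exact (RunsIn.pop_true (k := 0) (by simp) rfl
      (RunsIn.pop_true (k := 0) (by simp) rfl h')).mono (by omega)

/-- `rawBits` presents the last symbol first, so putting each symbol in front of the list on stack 1
restores the order of the input, and the induction is on the last symbol. -/
theorem run_symLoop (x y : List Γ') :
    RunsIn (.loop 0 (symRead false) (symRead true)) (st [rawBits x, cod y, []])
      (24 * x.length + 1) (st [[], cod (x ++ y), []]) := by
  induction x using List.reverseRecOn generalizing y with
  | nil => exact .loop_nil (by simp) rfl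
  | append_singleton x a ih =>
    have h1 : rawBits (x ++ [a]) =
        (symBits a).1 :: (symBits a).2.1 :: (symBits a).2.2 :: rawBits x := by
      simp [rawBits]
    have h2 := run_symRead (symBits a).1 (symBits a).2.1 (symBits a).2.2 (rawBits x) (cod y)
    have h3 : RunsIn (if (symBits a).1 then symRead true else symRead false) (st
        [(symBits a).2.1 :: (symBits a).2.2 :: rawBits x, cod y, []]) 22
        (st [rawBits x, cod (a :: y), []]) := by
      cases h : (symBits a).1 <;> rw [h] at h2 <;> simp only [Bool.false_eq_true, if_true, if_false]
      all_goals
        convert h2 using 3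
        rw [cod_cons, ← h]; rfl
    have h4 := RunsIn.loop_cons (L := [rawBits (x ++ [a]), cod y, []]) (k := 0)
      (p₀ := symRead false) (p₁ := symRead true) (by simp) h1 h3 (ih (a :: y))
    rw [List.append_assoc, List.singleton_append]
    refine h4.mono ?_
    simp; omega

theorem size_symbol (a : Γ') : size a = 17 := by
  have : size a = size ((symBits a).1, (symBits a).2.1, (symBits a).2.2) := rfl
  rw [this, size_pair, size_pair, size_bool, size_bool, size_bool]

theorem size_string (x : List Γ') : size x = 18 * x.length + 1 := by
  induction x with
  | nil => rfl
  | cons a x ih => rw [size_cons, size_symbol, List.length_cons]; omega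

/-- A language is in P if it is decided by a function that is computable in polynomial time. -/
theorem inP_of_poly {L : Language Γ'} (f : List Γ' → Bool) (hf : Poly f)
    (hL : ∀ x, f x = true ↔ x ∈ L) : InP L := by
  obtain ⟨p, q, hp⟩ := hf
  refine inP_of_run f hL (.seq (.push 1 false) <| .seq (.loop 0 (symRead false) (symRead true)) <|
    .seq (move 1 2) <| .seq (move 2 0) <| .seq (p.shift 0) <|
    .pop 0 .skip (.pop 0 (.seq (clear 0) (.push 0 false)) (.seq (clear 0) (.push 0 true)) .skip)
      .skip) (140 * Polynomial.X + q.comp (18 * Polynomial.X + 1) + 30) fun x => ?_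
  -- The single `false` is the code of the empty list, to which the symbols are added.
  have h1 := run_push [rawBits x, [], []] 1 false (by simp)
  have h2 := run_symLoop x []
  have h3 := run_move [[], cod x, []] 1 2 (by simp) (by simp) (by simp)
  have h4 := run_move [[], [], (cod x).reverse] 2 0 (by simp) (by simp) (by simp)
  have h5 := (hp x).at [] 2
  -- The tree code of the answer is replaced by the one bit that the machine has to output.
  have h6 : RunsIn (.pop 0 .skip (.pop 0 (.seq (clear 0) (.push 0 false))
      (.seq (clear 0) (.push 0 true)) .skip) .skip) (st [cod (f x), [], []]) 12
      (st [[f x], [], []]) := by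
    cases f x with
    | false =>
      have h6 := run_clear [[true, false, false], [], []] 0 (by simp)
      exact (RunsIn.pop_true (k := 0) (by simp) rfl <| RunsIn.pop_false (k := 0) (by simp) rfl <|
        h6.seq (run_push [[], [], []] 0 false (by simp))).mono (by simp)
    | true =>
      have h6 := run_clear [[false, false, false], [], []] 0 (by simp)
      exact (RunsIn.pop_true (k := 0) (by simp) rfl <| RunsIn.pop_true (k := 0) (by simp) rfl <|
        h6.seq (run_push [[], [], []] 0 true (by simp))).mono (by simp)
  simp [length_cod] at h1 h2 h3 h4 h5
  have key := h1.seq <| h2.seq <| h3.seq <| h4.seq <| h5.seq h6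
  rw [show st [rawBits x, [], []] = st [rawBits x] from st_pad [rawBits x] 2,
    show st [[f x], [], []] = st [[f x]] from st_pad [[f x]] 2] at key
  refine key.mono ?_
  have h8 := size_string x
  have h9 := eval_mono q h8.le
  simp only [Polynomial.eval_add, Polynomial.eval_mul, Polynomial.eval_X, Polynomial.eval_ofNat,
    Polynomial.eval_comp, Polynomial.eval_one]
  omega

/-! ### Booleans, options and lists -/

@[fun_prop]
theorem Poly.cond {c : α → Bool} {f g : α → β} (hc : Poly c) (hf : Poly f) (hg : Poly g) :
    Poly fun a => bif c a then f a else g a := by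
  simpa only [cond_eq_ite] using hc.ite hf hg

@[fun_prop]
theorem Poly.and {f g : α → Bool} (hf : Poly f) (hg : Poly g) : Poly fun a => f a && g a := by
  have : Poly fun a => bif f a then g a else false := by fun_prop
  convert this using 2 with a
  cases f a <;> rfl

@[fun_prop]
theorem Poly.or {f g : α → Bool} (hf : Poly f) (hg : Poly g) : Poly fun a => f a || g a := by
  have : Poly fun a => bif f a then true else g a := by fun_prop
  convert this using 2 with a
  cases f a <;> rfl

@[fun_prop]
theorem Poly.not {f : α → Bool} (hf : Poly f) : Poly fun a => !f a := by
  have : Poly fun a => bif f a then false else true := by fun_prop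
  convert this using 2 with a
  cases f a <;> rfl

@[fun_prop]
theorem Poly.beq {f g : α → Bool} (hf : Poly f) (hg : Poly g) : Poly fun a => f a == g a := by
  have : Poly fun a => bif f a then g a else !g a := by fun_prop
  convert this using 2 with a
  cases f a <;> cases g a <;> rfl

@[fun_prop]
theorem Poly.cons {f : α → β} {g : α → List β} (hf : Poly f) (hg : Poly g) :
    Poly fun a => f a :: g a :=
  (Poly.of_toD (f := fun p : β × List β => p.1 :: p.2) _ .id fun _ => rfl).comp (hf.pair hg)

@[fun_prop]
theorem Poly.tail {f : α → List β} (hf : Poly f) : Poly fun a => (f a).tail :=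
  (Poly.of_toD (f := fun l : List β => l.tail) _ .right fun l => by cases l <;> rfl).comp hf

/-- Whether a tree is a leaf. -/
def isLeaf : D → Bool
  | .leaf => true
  | .node _ _ => false

theorem Poly.isLeaf : Poly isLeaf := by
  refine ⟨.pop 0 (pushList 0 (cod true)) (.seq (clear 0) (pushList 0 (cod false))) .skip,
    2 * Polynomial.X + 8, fun d => ?_⟩
  have h2 := run_pushList [[]] 0 (cod (PolyTime.isLeaf d)) (by simp)
  simp [length_cod, size_bool] at h2
  cases d with
  | leaf => exact (RunsIn.pop_false (k := 0) (by simp) (l := []) rfl h2).mono (by simp)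
  | node a b =>
    have h1 := run_clear [a.code ++ b.code] 0 (by simp)
    refine (RunsIn.pop_true (k := 0) (by simp) (l := a.code ++ b.code) rfl (h1.seq h2)).mono ?_
    simp [size, toD, D.size, D.code]

@[fun_prop]
theorem Poly.isEmpty {f : α → List β} (hf : Poly f) : Poly fun a => (f a).isEmpty :=
  (Poly.of_toD (f := fun l : List β => l.isEmpty) (fun d => toD (PolyTime.isLeaf d)) (
    (Poly.of_toD (f := fun b : Bool => toD b) _ .id fun _ => rfl).comp .isLeaf)
    fun l => by cases l <;> rfl).comp hf

theorem Poly.toD : Poly fun a : α => Enc.toD a := .of_toD _ .id fun _ => rfl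

theorem Poly.node {f g : α → D} (hf : Poly f) (hg : Poly g) : Poly fun a => D.node (f a) (g a) :=
  (Poly.of_toD (f := fun p : D × D => D.node p.1 p.2) _ .id fun _ => rfl).comp (hf.pair hg)

@[fun_prop]
theorem Poly.head? {f : α → List β} (hf : Poly f) : Poly fun a => (f a).head? :=
  (Poly.of_toD (f := fun l : List β => l.head?)
    (fun d => if PolyTime.isLeaf d = true then D.leaf else D.node d.left .leaf)
    (Poly.isLeaf.ite (.const _) (.node .left (.const _))) fun l => by cases l <;> rfl).comp hf

@[fun_prop]
theorem Poly.some {f : α → β} (hf : Poly f) : Poly fun a => Option.some (f a) :=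
  (Poly.of_toD (f := fun b : β => Option.some b) (fun d => D.node d .leaf) (.node .id (.const _))
    fun _ => rfl).comp hf

@[fun_prop]
theorem Poly.isSome {f : α → Option β} (hf : Poly f) : Poly fun a => (f a).isSome :=
  (Poly.of_toD (f := fun l : Option β => l.isSome) (fun d => Enc.toD (!PolyTime.isLeaf d)) (
    Poly.toD.comp (Poly.not .isLeaf)) fun l => by cases l <;> rfl).comp hf

@[fun_prop]
theorem Poly.getD {f : α → Option β} {g : α → β} (hf : Poly f) (hg : Poly g) :
    Poly fun a => (f a).getD (g a) :=
  (Poly.of_toD (f := fun p : Option β × β => p.1.getD p.2)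
    (fun d => if PolyTime.isLeaf d.left = true then d.right else d.left.left)
    ((Poly.isLeaf.comp .left).ite .right (Poly.left.comp .left))
    fun ⟨l, _⟩ => by cases l <;> rfl).comp (hf.pair hg)

/-- Folds are computed in polynomial time if every step has a bounded contribution. -/
theorem Poly.foldl_of_size_le {s : α → β → γ → β} {i : α → β} {l : α → List γ}
    (hs : Poly fun a : α × β × γ => s a.1 a.2.1 a.2.2) (hi : Poly i) (hl : Poly l)
    (B : Polynomial ℕ) (hB : ∀ x b c, size (s x b c) ≤ size b + B.eval (size x + size c)) :
    Poly fun x => (l x).foldl (s x) (i x) := by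
  obtain ⟨Bi, hBi⟩ := hi.size_le
  obtain ⟨Bl, hBl⟩ := hl.size_le
  refine hs.foldl hi hl (Bi + Bl * B.comp (Polynomial.X + Bl)) fun x l' h' => ?_
  have key : ∀ (l' : List γ) (b : β), (∀ c ∈ l', c ∈ l x) → size (l'.foldl (s x) b) ≤
      size b + l'.length * B.eval (size x + Bl.eval (size x)) := by
    intro l'
    induction l' with
    | nil => simp
    | cons c l' ih =>
      intro b hc
      have h1 := ih (s x b c) fun c' h => hc c' (List.mem_cons_of_mem _ h)
      have h2 := hB x b c
      have h3 := size_le_of_mem (hc c List.mem_cons_self)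
      have h4 := eval_mono B (show size x + size c ≤ size x + Bl.eval (size x) by
        have := hBl x; omega)
      rw [List.foldl_cons, List.length_cons, Nat.add_mul]
      omega
  have h1 := key l' (i x) fun c h => h'.subset h
  have h2 : l'.length ≤ Bl.eval (size x) :=
    (h'.length_le.trans (length_le_size _)).trans (hBl x)
  have h3 := Nat.mul_le_mul_right (B.eval (size x + Bl.eval (size x))) h2
  have h4 := hBi x
  simp only [Polynomial.eval_add, Polynomial.eval_mul, Polynomial.eval_X, Polynomial.eval_comp]
  omega

@[fun_prop]
theorem Poly.reverse {f : α → List β} (hf : Poly f) : Poly fun a => (f a).reverse := by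
  have : Poly fun l : List β => l.foldl (fun acc a => a :: acc) [] :=
    Poly.foldl_of_size_le (s := fun _ acc a => a :: acc) (i := fun _ => []) (l := fun l => l)
      (by fun_prop) (by fun_prop) (by fun_prop)
      (Polynomial.X + 1) fun x b c => by simp [size_cons]; omega
  have h : (fun l : List β => l.foldl (fun acc a => a :: acc) []) = fun l => l.reverse := by
    funext l; simp
  rw [h] at this
  exact this.comp hf

@[fun_prop]
theorem Poly.map {f : α → β → γ} {l : α → List β} (hf : Poly fun p : α × β => f p.1 p.2)
    (hl : Poly l) : Poly fun a => (l a).map fun b => f a b := by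
  obtain ⟨q, hq⟩ := hf.size_le
  have : Poly fun x => ((l x).foldl (fun acc b => f x b :: acc) []).reverse :=
    Poly.reverse <| Poly.foldl_of_size_le (s := fun x acc b => f x b :: acc) (i := fun _ => [])
      (.cons (hf.comp (f := fun p : α × _ × β => (p.1, p.2.2)) (by fun_prop)) (by fun_prop)) (by fun_prop) hl
      (q.comp (Polynomial.X + 1) + 1) fun x b c => by
        have := hq (x, c)
        simp only [size_pair] at this
        simp [size_cons]; omega
  convert this using 2 with x
  rw [← List.foldl_map (f := f x) (g := fun acc b => b :: acc)]
  simp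

/-- Folds with values of bounded size are computed in polynomial time. -/
theorem Poly.foldl_of_bounded {s : α → β → γ → β} {i : α → β} {l : α → List γ}
    (hs : Poly fun a : α × β × γ => s a.1 a.2.1 a.2.2) (hi : Poly i) (hl : Poly l)
    (n : ℕ) (hB : ∀ b : β, size b ≤ n) : Poly fun x => (l x).foldl (s x) (i x) :=
  hs.foldl_of_size_le hi hl (Polynomial.C n) fun x b c => by
    have := hB (s x b c)
    simp; omega

@[fun_prop]
theorem Poly.any {f : α → β → Bool} {l : α → List β} (hf : Poly fun p : α × β => f p.1 p.2)
    (hl : Poly l) : Poly fun a => (l a).any fun b => f a b := by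
  have : Poly fun x => (l x).foldl (fun r b => r || f x b) false :=
    Poly.foldl_of_bounded (s := fun x r b => r || f x b) (i := fun _ => false)
      (.or (by fun_prop) (hf.comp (f := fun p : α × _ × β => (p.1, p.2.2)) (by fun_prop))) (by fun_prop) hl 5 fun b => (size_bool b).le
  convert this using 2 with x
  have : ∀ (l : List β) r, l.foldl (fun r b => r || f x b) r = (r || l.any (f x)) := by
    intro l
    induction l with
    | nil => simp
    | cons b l ih => intro r; simp [ih, Bool.or_assoc]
  simp [this]

@[fun_prop]
theorem Poly.all {f : α → β → Bool} {l : α → List β} (hf : Poly fun p : α × β => f p.1 p.2)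
    (hl : Poly l) : Poly fun a => (l a).all fun b => f a b := by
  have : Poly fun a => !((l a).any fun b => !f a b) := by fun_prop
  convert this using 2 with x
  rw [List.all_eq_not_any_not]

end PolyTime

namespace PolyTime

open Function Enc
open Computability (Γ')

variable {α β γ δ : Type} [Enc α] [Enc β] [Enc γ] [Enc δ]

/-! ### More functions on lists -/

theorem size_append (l m : List α) : size (l ++ m) + 1 = size l + size m := by
  induction l with
  | nil => simp [size_nil, Nat.add_comm]
  | cons a l ih => rw [List.cons_append, size_cons, size_cons]; omega

theorem size_tail_le (l : List α) : size l.tail ≤ size l := by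
  cases l with
  | nil => exact le_rfl
  | cons a l => rw [List.tail_cons, size_cons]; omega

@[fun_prop]
theorem Poly.append {f g : α → List β} (hf : Poly f) (hg : Poly g) : Poly fun a => f a ++ g a := by
  have : Poly fun x => (f x).reverse.foldl (fun acc b => b :: acc) (g x) :=
    Poly.foldl_of_size_le (s := fun _ acc b => b :: acc) (by fun_prop) hg (by fun_prop)
      (Polynomial.X + 1) fun x b c => by simp [size_cons]; omega
  convert this using 2 with x
  simp

@[fun_prop]
theorem Poly.filter {f : α → β → Bool} {l : α → List β} (hf : Poly fun p : α × β => f p.1 p.2)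
    (hl : Poly l) : Poly fun a => (l a).filter fun b => f a b := by
  have : Poly fun x => ((l x).foldl (fun acc b => bif f x b then b :: acc else acc) []).reverse :=
    Poly.reverse <| Poly.foldl_of_size_le (s := fun x acc b => bif f x b then b :: acc else acc)
      (i := fun _ => [])
      (.cond (hf.comp (f := fun p : α × _ × β => (p.1, p.2.2)) (by fun_prop)) (by fun_prop)
        (by fun_prop)) (by fun_prop) hl (Polynomial.X + 1) fun x b c => by
        cases f x c <;> simp [size_cons]; omega
  convert this using 2 with x
  have : ∀ (l acc : List β), (l.foldl (fun acc b => bif f x b then b :: acc else acc) acc).reverse =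
      acc.reverse ++ l.filter fun b => f x b := by
    intro l
    induction l with
    | nil => simp
    | cons b l ih => intro acc; cases h : f x b <;> simp [ih, h]
  simp [this]

@[fun_prop]
theorem Poly.flatMap {f : α → β → List γ} {l : α → List β} (hf : Poly fun p : α × β => f p.1 p.2)
    (hl : Poly l) : Poly fun a => (l a).flatMap fun b => f a b := by
  obtain ⟨q, hq⟩ := hf.size_le
  have : Poly fun x => (l x).foldl (fun acc b => acc ++ f x b) [] :=
    Poly.foldl_of_size_le (s := fun x acc b => acc ++ f x b)
      (i := fun _ => [])
      (.append (by fun_prop) (hf.comp (f := fun p : α × _ × β => (p.1, p.2.2)) (by fun_prop)))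
      (by fun_prop) hl (q.comp (Polynomial.X + 1)) fun x b c => by
        have h1 := hq (x, c)
        have h2 := size_append b (f x c)
        simp only [size_pair] at h1
        simp; omega
  convert this using 2 with x
  have : ∀ (l : List β) (acc : List γ), l.foldl (fun acc b => acc ++ f x b) acc =
      acc ++ l.flatMap fun b => f x b := by
    intro l
    induction l with
    | nil => simp
    | cons b l ih => intro acc; simp [ih]
  simp [this]

@[fun_prop]
-- The fold carries a flag that becomes false at the first entry violating `f` and stays false.
theorem Poly.takeWhile {f : α → β → Bool} {l : α → List β} (hf : Poly fun p : α × β => f p.1 p.2)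
    (hl : Poly l) : Poly fun a => (l a).takeWhile fun b => f a b := by
  have hf' : Poly fun p : α × (Bool × List β) × β => f p.1 p.2.2 :=
    hf.comp (f := fun p : α × (Bool × List β) × β => (p.1, p.2.2)) (by fun_prop)
  have : Poly fun x => ((l x).foldl (fun s b => bif s.1 && f x b then (true, b :: s.2) else
      (false, s.2)) (true, ([] : List β))).2.reverse :=
    Poly.reverse <| Poly.comp (g := Prod.snd) .snd <|
      Poly.foldl_of_size_le (s := fun x s b => bif s.1 && f x b then (true, b :: s.2) else
      (false, s.2)) (i := fun _ => (true, ([] : List β)))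
      (.cond (.and (by fun_prop) hf') (by fun_prop) (by fun_prop)) (by fun_prop) hl
      (Polynomial.X + 1) fun x b c => by
        obtain ⟨b₁, b₂⟩ := b
        cases b₁ && f x c <;> simp [size_cons, size_pair, size_bool]
        omega
  convert this using 2 with x
  have h0 : ∀ (l acc : List β), (l.foldl (fun s b => bif s.1 && f x b then (true, b :: s.2) else
      (false, s.2)) (false, acc)).2 = acc := by
    intro l
    induction l with
    | nil => simp
    | cons b l ih => intro acc; simp [ih]
  have : ∀ (l acc : List β), (l.foldl (fun s b => bif s.1 && f x b then (true, b :: s.2) else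
      (false, s.2)) (true, acc)).2.reverse = acc.reverse ++ l.takeWhile fun b => f x b := by
    intro l
    induction l with
    | nil => simp
    | cons b l ih => intro acc; cases h : f x b <;> simp [ih, h, h0]
  simp [this]

@[fun_prop]
-- The list serves twice, as the state to be shortened and as a counter that allows enough steps.
-- That `takeWhile` is nonempty tests whether the head satisfies `f`.
theorem Poly.dropWhile {f : β → Bool} {l : α → List β} (hf : Poly f) (hl : Poly l) :
    Poly fun a => (l a).dropWhile f := by
  have : Poly fun x => (l x).foldl (fun r _ => bif (r.head?.isSome && !(r.takeWhile f).isEmpty)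
      then r.tail else r) (l x) :=
    Poly.foldl_of_size_le (s := fun _ (r : List β) _ => bif (r.head?.isSome && !(r.takeWhile f).isEmpty)
      then r.tail else r) (by fun_prop) (by fun_prop) hl 0 fun x b c => by
        have := size_tail_le b
        cases b.head?.isSome && !(b.takeWhile f).isEmpty <;> simp
        omega
  convert this using 2 with x
  have : ∀ (l r : List β), r.length ≤ l.length → l.foldl (fun r _ =>
      bif (r.head?.isSome && !(r.takeWhile f).isEmpty) then r.tail else r) r = r.dropWhile f := by
    intro l
    induction l with
    | nil => intro r hr; simp at hr; simp [hr]
    | cons b l ih =>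
      intro r hr
      cases r with
      | nil => exact ih [] (by simp)
      | cons c r =>
        rw [List.foldl_cons]
        cases h : f c
        · simp only [List.takeWhile_cons, h, List.dropWhile_cons]
          have h0 : ∀ l : List β, l.foldl (fun r _ =>
            bif (r.head?.isSome && !(r.takeWhile f).isEmpty) then r.tail else r) (c :: r) =
              c :: r := by
            intro l
            induction l with
            | nil => rfl
            | cons b l ih => simpa [h] using ih
          simpa using h0 l
        · simp only [List.takeWhile_cons, h, List.dropWhile_cons]
          simpa using ih r (by simpa using hr)
  exact (this _ _ le_rfl).symm

/-! ### Equality -/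

/-- Equality is decided in polynomial time. -/
class PolyEq (β : Type) [Enc β] : Prop where
  out : ∃ e : β × β → Bool, Poly e ∧ ∀ p, e p = true ↔ p.1 = p.2

@[fun_prop]
theorem Poly.decide_eq [PolyEq β] {f g : α → β} {_ : ∀ a, Decidable (f a = g a)} (hf : Poly f)
    (hg : Poly g) : Poly fun a => decide (f a = g a) := by
  obtain ⟨e, he, h⟩ := PolyEq.out (β := β)
  have : Poly fun a => e (f a, g a) := by fun_prop
  convert this using 2 with a
  rw [Bool.eq_iff_iff, h]
  simp

instance : PolyEq Bool := ⟨fun p => p.1 == p.2, by fun_prop, by simp⟩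

theorem PolyEq.of_injective [PolyEq γ] (f : β → γ) (hf : Poly f) (h : Injective f) : PolyEq β := by
  classical
  exact ⟨fun p => decide (f p.1 = f p.2), by fun_prop, fun p => by simpa using h.eq_iff⟩

instance [PolyEq α] [PolyEq β] : PolyEq (α × β) := by
  classical
  exact ⟨fun p => decide (p.1.1 = p.2.1) && decide (p.1.2 = p.2.2), by fun_prop,
    fun p => by simp [Prod.ext_iff]⟩

instance : PolyEq Γ' := by
  refine .of_injective symBits (.of_toD _ .id fun _ => rfl) fun a b h => ?_
  cases a with
  | bit a => cases b with
    | bit b => simp only [symBits, Prod.mk.injEq, true_and] at h; rw [h]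
    | _ => simp [symBits] at h
  | _ => cases b with
    | bit b => simp [symBits] at h
    | _ => first | rfl | simp [symBits] at h

instance [PolyEq β] : PolyEq (List β) := by
  classical
  -- The fold compares each entry of the first list with the head of what is left of the second. The
  -- default value in `getD` would pass the comparison, so `isSome` is tested as well.
  refine ⟨fun p => (fun s : Bool × List β => s.1 && s.2.isEmpty) (p.1.foldl (fun s b =>
    (s.1 && (s.2.head?.isSome && decide (s.2.head?.getD b = b)), s.2.tail)) (true, p.2)), ?_, ?_⟩
  · refine Poly.comp (g := fun s : Bool × List β => s.1 && s.2.isEmpty) (by fun_prop) <|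
      Poly.foldl_of_size_le (s := fun _ (s : Bool × List β) b =>
        (s.1 && (s.2.head?.isSome && decide (s.2.head?.getD b = b)), s.2.tail))
      (i := fun p : List β × List β => (true, p.2)) (l := fun p => p.1)
      (by fun_prop) (by fun_prop) (by fun_prop) 0 fun x b c => ?_
    obtain ⟨b₁, b₂⟩ := b
    have := size_tail_le b₂
    simp only [size_pair, size_bool]
    omega
  · have key : ∀ (l r : List β) (b : Bool), (fun s : Bool × List β => s.1 && s.2.isEmpty)
        (l.foldl (fun s b => (s.1 && (s.2.head?.isSome && decide (s.2.head?.getD b = b)), s.2.tail))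
        (b, r)) = true ↔ b = true ∧ l = r := by
      intro l
      induction l with
      | nil => intro r b; cases r <;> simp
      | cons c l ih =>
        intro r b
        rw [List.foldl_cons, ih]
        cases r with
        | nil => simp
        | cons d r =>
          simp [and_assoc, eq_comm (a := c)]
          intros
          exact decide_eq_true_iff
    intro p
    rw [key]; simp

/-! ### Numbers -/

/-- The value of a list of binary digits, least significant first. -/
def ofBits : List Bool → ℕ
  | [] => 0
  | b :: l => b.toNat + 2 * ofBits l

/-- Remove leading zeros. -/
def strip : List Bool → List Bool
  | [] => []
  | b :: l => bif (strip l).isEmpty && !b then [] else b :: strip l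

open Computability (encodeNat)

theorem encodeNat_bit1 (n : ℕ) : encodeNat (1 + 2 * n) = true :: encodeNat n := by
  have h : ((1 + 2 * n : ℕ) : Num) = Num.bit1 (n : Num) := by
    rw [show (Num.bit1 (n : Num)) = (n : Num) + n + 1 from Num.bit1_of_bit1 _ |>.symm]
    push_cast
    ring
  unfold encodeNat
  rw [h]
  cases (n : Num) <;> rfl

theorem encodeNat_bit0 (n : ℕ) (hn : n ≠ 0) : encodeNat (2 * n) = false :: encodeNat n := by
  have h : ((2 * n : ℕ) : Num) = Num.bit0 (n : Num) := by
    rw [show (Num.bit0 (n : Num)) = (n : Num) + n from Num.bit0_of_bit0 _ |>.symm]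
    push_cast
    ring
  unfold encodeNat
  rw [h]
  cases h : (n : Num) with
  | zero =>
    exfalso
    apply hn
    have := congrArg (fun m : Num => (m : ℕ)) h
    simpa using this
  | pos m => rfl

theorem encodeNat_eq_nil {n : ℕ} : encodeNat n = [] ↔ n = 0 := by
  constructor
  · intro h
    rw [← Computability.decode_encodeNat n, h]; rfl
  · rintro rfl; rfl

/-- `encodeNat` yields the digits without leading zeros, so `strip` brings any list of digits into
this canonical form. -/
theorem encodeNat_ofBits (l : List Bool) : encodeNat (ofBits l) = strip l := by
  induction l with
  | nil => rfl
  | cons b l ih =>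
    unfold ofBits strip
    rw [← ih]
    cases b
    · by_cases h : ofBits l = 0
      · rw [h]; rfl
      · rw [Bool.toNat_false, Nat.zero_add, encodeNat_bit0 _ h]
        have : encodeNat (ofBits l) ≠ [] := fun h' => h (encodeNat_eq_nil.1 h')
        cases h' : encodeNat (ofBits l) with
        | nil => exact absurd h' this
        | cons => rfl
    · rw [Bool.toNat_true, encodeNat_bit1]; simp

theorem encodeNat_injective : Injective encodeNat := Computability.encodingNatBool.encode_injective

theorem ofBits_strip (l : List Bool) : ofBits (strip l) = ofBits l := by
  induction l with
  | nil => rfl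
  | cons b l ih =>
    rw [strip]
    cases b with
    | false =>
      cases h : strip l with
      | nil => rw [h] at ih; simp [ofBits] at ih ⊢; exact ih.symm
      | cons c m => rw [h] at ih; simp [ofBits] at ih ⊢; exact ih
    | true => simp [ofBits, ih]

theorem exists_ofBits (n : ℕ) : ∃ l, ofBits l = n := by
  induction n using Nat.strong_induction_on with
  | _ n ih =>
    by_cases hn : n = 0
    · exact ⟨[], hn.symm⟩
    · obtain ⟨l, hl⟩ := ih (n / 2) (by omega)
      rcases Nat.mod_two_eq_zero_or_one n with h | h
      · exact ⟨false :: l, by simp [ofBits, hl]; omega⟩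
      · exact ⟨true :: l, by simp [ofBits, hl]; omega⟩

theorem ofBits_encodeNat (n : ℕ) : ofBits (encodeNat n) = n := by
  obtain ⟨l, rfl⟩ := exists_ofBits n
  rw [encodeNat_ofBits, ofBits_strip]

/-- Numbers are represented by their binary digits, so `Poly` means polynomial in the bit length and
not in the value. -/
instance : Enc ℕ := ⟨fun n => toD (encodeNat n)⟩

theorem size_bits (l : List Bool) : size l = 6 * l.length + 1 := by
  induction l with
  | nil => rfl
  | cons b l ih => rw [size_cons, size_bool, ih, List.length_cons]; omega

theorem size_nat (n : ℕ) : size n = 6 * (encodeNat n).length + 1 := size_bits (encodeNat n)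

theorem Poly.of_eq_toD {f : α → β} {g : α → γ} (hg : Poly g) (h : ∀ a, Enc.toD (g a) = Enc.toD (f a)) :
    Poly f := by
  obtain ⟨p, q, hp⟩ := hg
  refine ⟨p, q, fun a => ?_⟩
  have := hp a
  unfold cod at this ⊢
  rwa [h] at this

@[fun_prop]
theorem Poly.encodeNat {f : α → ℕ} (hf : Poly f) : Poly fun a => Computability.encodeNat (f a) :=
  (Poly.of_toD (f := fun n : ℕ => Computability.encodeNat n) _ .id fun _ => rfl).comp hf

instance : PolyEq ℕ := .of_injective encodeNat (by fun_prop) encodeNat_injective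

/-- `strip` recurses from the far end of the list; as a left fold over the reversed list it falls
under `Poly.foldl`. -/
theorem strip_eq_foldl (l : List Bool) : strip l =
    l.reverse.foldl (fun acc b => bif acc.isEmpty && !b then [] else b :: acc) [] := by
  rw [List.foldl_reverse]
  induction l with
  | nil => rfl
  | cons b l ih => rw [strip, List.foldr_cons, ih]

theorem length_strip_le (l : List Bool) : (strip l).length ≤ l.length := by
  induction l with
  | nil => exact le_rfl
  | cons b l ih =>
    rw [strip]
    cases (strip l).isEmpty && !b <;> simp; omega

@[fun_prop]
theorem Poly.ofBits {f : α → List Bool} (hf : Poly f) : Poly fun a => PolyTime.ofBits (f a) := by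
  have h : Poly fun l : List Bool => strip l := by
    have : Poly fun l : List Bool =>
        l.reverse.foldl (fun acc b => bif acc.isEmpty && !b then [] else b :: acc) [] :=
      Poly.foldl_of_size_le (s := fun (_ : List Bool) acc b =>
        bif acc.isEmpty && !b then [] else b :: acc)
        (i := fun _ => []) (by fun_prop) (by fun_prop) (by fun_prop) (Polynomial.X + 1)
        fun x b c => by
          have := size_pos b
          cases b.isEmpty && !c <;> simp [size_cons, size_nil] <;> omega
    simpa only [strip_eq_foldl] using this
  -- The representation of `ofBits l` is that of the list `strip l`, so computing `strip` is enough.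
  refine Poly.comp (g := PolyTime.ofBits) (h.of_eq_toD fun l => ?_) hf
  rw [← encodeNat_ofBits]; rfl

/-! ### Comparison and addition of binary numbers. -/

/-- The pairs of digits of two numbers. -/
def zipBits (a b : List Bool) : List (Bool × Bool) :=
  ((a ++ b).foldl (fun (s : List Bool × List Bool × List (Bool × Bool)) _ =>
    (s.1.tail, s.2.1.tail, (s.1.head?.getD false, s.2.1.head?.getD false) :: s.2.2))
    (a, b, [])).2.2.reverse

/-- The list `a ++ b` only counts steps. It is at least as long as `a` and as `b`, and missing
digits are filled with zeros, which do not change the values. -/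
theorem zipBits_spec (a b : List Bool) : ofBits ((zipBits a b).map Prod.fst) = ofBits a ∧
    ofBits ((zipBits a b).map Prod.snd) = ofBits b ∧
    (zipBits a b).length = a.length + b.length := by
  have key : ∀ (l a b : List Bool) (o : List (Bool × Bool)), a.length ≤ l.length →
      b.length ≤ l.length → ∃ z, (l.foldl
      (fun (s : List Bool × List Bool × List (Bool × Bool)) _ =>
        (s.1.tail, s.2.1.tail, (s.1.head?.getD false, s.2.1.head?.getD false) :: s.2.2))
        (a, b, o)).2.2.reverse = o.reverse ++ z ∧ ofBits (z.map Prod.fst) = ofBits a ∧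
        ofBits (z.map Prod.snd) = ofBits b ∧ z.length = l.length := by
    intro l
    induction l with
    | nil =>
      intro a b o ha hb
      simp only [List.length_nil, Nat.le_zero_eq, List.length_eq_zero_iff] at ha hb
      subst ha hb
      exact ⟨[], by simp⟩
    | cons c l ih =>
      intro a b o ha hb
      obtain ⟨z, h1, h2, h3, h4⟩ := ih a.tail b.tail
        ((a.head?.getD false, b.head?.getD false) :: o) (by simpa using ha) (by simpa using hb)
      refine ⟨(a.head?.getD false, b.head?.getD false) :: z, ?_, ?_, ?_, by simp [h4]⟩
      · rw [List.foldl_cons, h1]; simp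
      · cases a <;> simp_all [ofBits]
      · cases b <;> simp_all [ofBits]
  obtain ⟨z, h1, h2, h3, h4⟩ := key (a ++ b) a b [] (by simp) (by simp)
  have : zipBits a b = z := by rw [zipBits, h1]; simp
  rw [this]
  exact ⟨h2, h3, by simpa using h4⟩

@[fun_prop]
theorem Poly.zipBits {f g : α → List Bool} (hf : Poly f) (hg : Poly g) :
    Poly fun a => PolyTime.zipBits (f a) (g a) := by
  have : Poly fun p : List Bool × List Bool => PolyTime.zipBits p.1 p.2 := by
    refine Poly.reverse <| Poly.comp (g := fun s : List Bool × List Bool × List (Bool × Bool) =>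
      s.2.2) (by fun_prop) <| Poly.foldl_of_size_le (s := fun _ s _ =>
        (s.1.tail, s.2.1.tail, (s.1.head?.getD false, s.2.1.head?.getD false) :: s.2.2))
      (i := fun p : List Bool × List Bool => (p.1, p.2, [])) (by fun_prop) (by fun_prop)
      -- A new entry costs 12: two booleans of size 5, the node of their pair and the node of the
      -- list.
      (by fun_prop) 12 fun x b c => ?_
    obtain ⟨b₁, b₂, b₃⟩ := b
    have h1 := size_tail_le b₁
    have h2 := size_tail_le b₂
    simp only [size_pair, size_bool, size_cons, Polynomial.eval_ofNat]
    omega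
  exact this.comp (hf.pair hg)

/-- Addition of digits, with a carry. -/
def addBits : Bool → List (Bool × Bool) → List Bool
  | c, [] => [c]
  | c, (x, y) :: z => xor c (xor x y) :: addBits (bif c then x || y else x && y) z

theorem ofBits_addBits (c : Bool) (z : List (Bool × Bool)) : ofBits (addBits c z) =
    c.toNat + ofBits (z.map Prod.fst) + ofBits (z.map Prod.snd) := by
  induction z generalizing c with
  | nil => simp [addBits, ofBits]
  | cons p z ih =>
    obtain ⟨x, y⟩ := p
    simp only [addBits, ofBits, ih, List.map_cons]
    cases c <;> cases x <;> cases y <;> simp <;> omega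

theorem length_addBits (c : Bool) (z : List (Bool × Bool)) :
    (addBits c z).length = z.length + 1 := by
  induction z generalizing c with
  | nil => rfl
  | cons p z ih => simp [addBits, ih]

theorem add_eq_ofBits (m n : ℕ) :
    m + n = ofBits (addBits false (zipBits (encodeNat m) (encodeNat n))) := by
  obtain ⟨h1, h2, -⟩ := zipBits_spec (encodeNat m) (encodeNat n)
  rw [ofBits_addBits, h1, h2, ofBits_encodeNat, ofBits_encodeNat]; simp

/-- Sizes grow only additively under addition, so sums accumulated in a fold stay of polynomial
size. -/
theorem size_add_le (m n : ℕ) : size (m + n) ≤ size m + size n + 5 := by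
  obtain ⟨-, -, h⟩ := zipBits_spec (encodeNat m) (encodeNat n)
  have h1 := length_strip_le (addBits false (zipBits (encodeNat m) (encodeNat n)))
  rw [← encodeNat_ofBits, ← add_eq_ofBits, length_addBits, h] at h1
  rw [size_nat, size_nat, size_nat]; omega

@[fun_prop]
theorem Poly.addBits {f : α → List (Bool × Bool)} (hf : Poly f) :
    Poly fun a => PolyTime.addBits false (f a) := by
  -- The iterated `==` of three booleans is their exclusive or, the digit of the sum; the first
  -- component of the state is the carry.
  have : Poly fun z : List (Bool × Bool) => (fun s : Bool × List Bool => s.2.reverse ++ [s.1])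
      (z.foldl (fun s p => (bif s.1 then p.1 || p.2 else p.1 && p.2,
        (s.1 == (p.1 == p.2)) :: s.2)) (false, [])) := by
    refine Poly.comp (g := fun s : Bool × List Bool => s.2.reverse ++ [s.1]) (by fun_prop) <|
      Poly.foldl_of_size_le (s := fun _ (s : Bool × List Bool) (p : Bool × Bool) =>
      (bif s.1 then p.1 || p.2 else p.1 && p.2, (s.1 == (p.1 == p.2)) :: s.2))
      (i := fun _ => (false, [])) (l := fun z => z) (by fun_prop) (by fun_prop) (by fun_prop) 6 fun x b c => ?_
    obtain ⟨b₁, b₂⟩ := b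
    simp only [size_pair, size_bool, size_cons, Polynomial.eval_ofNat]
    omega
  refine Poly.comp (g := PolyTime.addBits false) ?_ hf
  convert this using 2 with z
  have key : ∀ (z : List (Bool × Bool)) (c : Bool) (o : List Bool),
      (fun s : Bool × List Bool => s.2.reverse ++ [s.1])
      (z.foldl (fun s p => (bif s.1 then p.1 || p.2 else p.1 && p.2,
        (s.1 == (p.1 == p.2)) :: s.2)) (c, o)) = o.reverse ++ PolyTime.addBits c z := by
    intro z
    induction z with
    | nil => intro c o; rfl
    | cons p z ih =>
      intro c o
      rw [List.foldl_cons, ih]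
      obtain ⟨x, y⟩ := p
      cases c <;> cases x <;> cases y <;> simp [PolyTime.addBits]
  exact (key z false []).symm

@[fun_prop]
theorem Poly.add {f g : α → ℕ} (hf : Poly f) (hg : Poly g) : Poly fun a => f a + g a := by
  simp only [add_eq_ofBits]
  fun_prop

/-- Digits come with the least significant first, so the last position where they differ decides.
The initial value `b` settles equality. -/
theorem foldl_le_bits (z : List (Bool × Bool)) (b : Bool) :
    z.foldl (fun r p => bif p.1 == p.2 then r else p.2) b = true ↔
      ofBits (z.map Prod.fst) < ofBits (z.map Prod.snd) ∨
      ofBits (z.map Prod.fst) = ofBits (z.map Prod.snd) ∧ b = true := by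
  induction z generalizing b with
  | nil => simp [ofBits]
  | cons p z ih =>
    obtain ⟨x, y⟩ := p
    rw [List.foldl_cons, ih]
    simp only [List.map_cons, ofBits]
    cases x <;> cases y <;> cases b <;> simp <;> omega

@[fun_prop]
theorem Poly.decide_le {f g : α → ℕ} (hf : Poly f) (hg : Poly g) :
    Poly fun a => decide (f a ≤ g a) := by
  have : Poly fun a =>
      (PolyTime.zipBits (Computability.encodeNat (f a)) (Computability.encodeNat (g a))).foldl
      (fun (r : Bool) (p : Bool × Bool) => bif p.1 == p.2 then r else p.2) Bool.true :=
    Poly.foldl_of_bounded (s := fun _ (r : Bool) (p : Bool × Bool) =>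
      bif p.1 == p.2 then r else p.2) (i := fun _ => Bool.true)
      (by fun_prop) (by fun_prop) (by fun_prop) 5 fun b => (size_bool b).le
  convert this using 2 with a
  obtain ⟨h1, h2, -⟩ := zipBits_spec (Computability.encodeNat (f a)) (Computability.encodeNat (g a))
  rw [Bool.eq_iff_iff, foldl_le_bits, h1, h2, ofBits_encodeNat, ofBits_encodeNat, decide_eq_true_iff]
  simp only [and_true]
  omega

@[fun_prop]
theorem Poly.sum_map {f : α → β → ℕ} {l : α → List β} (hf : Poly fun p : α × β => f p.1 p.2)
    (hl : Poly l) : Poly fun a => ((l a).map fun b => f a b).sum := by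
  obtain ⟨q, hq⟩ := hf.size_le
  have : Poly fun x => (l x).foldl (fun n b => n + f x b) 0 :=
    Poly.foldl_of_size_le (s := fun x n b => n + f x b) (i := fun _ => 0)
      (.add (by fun_prop) (hf.comp (f := fun p : α × _ × β => (p.1, p.2.2)) (by fun_prop)))
      (by fun_prop) hl (q.comp (Polynomial.X + 1) + 5) fun x b c => by
        have h1 := hq (x, c)
        have h2 := size_add_le b (f x c)
        simp only [size_pair] at h1
        simp; omega
  convert this using 2 with x
  rw [List.sum_eq_foldl, List.foldl_map]

@[fun_prop]
theorem Poly.length {l : α → List β} (hl : Poly l) : Poly fun a => (l a).length := by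
  have : Poly fun a => ((l a).map fun _ => 1).sum := by fun_prop
  simpa using this

@[fun_prop]
theorem Poly.countP {f : α → β → Bool} {l : α → List β} (hf : Poly fun p : α × β => f p.1 p.2)
    (hl : Poly l) : Poly fun a => (l a).countP fun b => f a b := by
  have : Poly fun a => (((l a).filter fun b => f a b).map fun _ => 1).sum := by fun_prop
  convert this using 2 with a
  rw [List.countP_eq_length_filter]; simp

end PolyTime

/-! ### Winning strategies of the briber -/

namespace Election

/-- The plurality score of `c` in a collection of weighted first choices. -/
def topScore (V : List (Option Name × ℕ)) (c : Name) : ℕ :=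
  (V.map fun v => bif decide (v.1 = some c) then v.2 else 0).sum

/-- The first choice of a vote, with the weight of the vote. -/
def WeightedVote.top (v : WeightedVote) : Option Name × ℕ := (v.vote.order.head?, v.weight)

theorem topScore_append (V : List (Option Name × ℕ)) (a : Option Name) (w : ℕ) (c : Name) :
    topScore (V ++ [(a, w)]) c = topScore V c + if a = some c then w else 0 := by
  by_cases h : a = some c <;> simp [topScore, h]

/-- Weights are written in binary, so the copies of a vote must never be listed; scores are computed
by adding weights instead. -/
theorem pluralityScore_eq (U : List WeightedVote) (c : Name) :
    pluralityScore (U.flatMap fun v => List.replicate v.weight v.vote) c =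
      topScore (U.map WeightedVote.top) c := by
  unfold pluralityScore topScore
  rw [List.countP_flatMap, List.map_map]
  congr 1
  refine List.map_congr_left fun v _ => ?_
  by_cases h : v.vote.order.head? = some c <;> simp [List.countP_replicate, WeightedVote.top, h]

/-- The candidates that the briber wants to win, or at least one of them. -/
def Version.good (σ : Pref) (d : Name) : Version → Name → Bool
  | .constructive, c => decide (σ.idxOf c ≤ σ.idxOf d)
  | .destructive, c => !decide (σ.idxOf d ≤ σ.idxOf c)

/-- The lead over the other candidates that is needed by some good candidate. -/
def Version.lead : Version → ℕ
  | .constructive => 0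
  | .destructive => 1

/-- Some good candidate, helped by `x` additional points, has a score of at least `m` more than
every bad candidate. -/
def Leads (C : List Name) (G : Name → Bool) (s : Name → ℕ) (m x : ℕ) : Prop :=
  ∃ g ∈ C, G g = true ∧ ∀ b ∈ C, G b = false → s b + m ≤ s g + x

theorem exists_max_score {C : List Name} (p : Name → Prop) (s : Name → ℕ) (h : ∃ c ∈ C, p c) :
    ∃ c ∈ C, p c ∧ ∀ b ∈ C, p b → s b ≤ s c := by
  classical
  obtain ⟨c, hc, hp⟩ := h
  obtain ⟨m, hm, h⟩ := (C.toFinset.filter p).exists_max_image s ⟨c, by simp [hc, hp]⟩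
  simp only [Finset.mem_filter, List.mem_toFinset] at hm h
  exact ⟨m, hm.1, hm.2, fun b hb hb' => h b ⟨hb, hb'⟩⟩

/-- In the constructive case the best good candidate wins as soon as one good candidate is not
beaten by any bad one. In the destructive case all winners are good exactly if some good candidate
is strictly ahead of all bad ones, because some winner always exists. -/
theorem goal_iff {p w : Bool} (I : OBS p w) (hd : I.d ∈ I.candidates) (U : List WeightedVote)
    (v : Version) : I.Goal plurality U v ↔
      Leads I.candidates (v.good I.briber I.d) (topScore (U.map WeightedVote.top)) v.lead 0 := by
  have hW : ∀ c, c ∈ plurality.weightedWinners I.candidates.toFinset U ↔ c ∈ I.candidates ∧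
      ∀ b ∈ I.candidates, topScore (U.map WeightedVote.top) b ≤
        topScore (U.map WeightedVote.top) c := by
    intro c
    unfold ElectionSystem.weightedWinners plurality
    simp only [Finset.mem_filter, List.mem_toFinset, pluralityScore_eq]
  generalize topScore (U.map WeightedVote.top) = s at *
  cases v with
  | constructive =>
    simp only [OBS.Goal, hW, Leads, Version.good, Version.lead, Pref.Geq, decide_eq_true_eq,
      decide_eq_false_iff_not, Nat.add_zero]
    constructor
    · rintro ⟨c, ⟨hc, h⟩, hg⟩
      exact ⟨c, hc, hg, fun b hb _ => h b hb⟩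
    · rintro ⟨g, hg, hgd, h⟩
      obtain ⟨c, hc, hcd, hmax⟩ := exists_max_score
        (fun c => I.briber.idxOf c ≤ I.briber.idxOf I.d) s ⟨g, hg, hgd⟩
      refine ⟨c, ⟨hc, fun b hb => ?_⟩, hcd⟩
      by_cases hbd : I.briber.idxOf b ≤ I.briber.idxOf I.d
      · exact hmax b hb hbd
      · exact (h b hb hbd).trans (hmax g hg hgd)
  | destructive =>
    simp only [OBS.Goal, hW, Leads, Version.good, Version.lead, Pref.Geq, Bool.not_eq_true',
      decide_eq_false_iff_not, Bool.not_eq_false', decide_eq_true_eq, Nat.add_zero]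
    constructor
    · intro h
      -- The candidate `d` makes the set of candidates nonempty; a bad candidate that ties with the
      -- maximum would be a winner itself.
      obtain ⟨c, hc, -, hmax⟩ := exists_max_score (fun _ => True) s ⟨I.d, hd, trivial⟩
      refine ⟨c, hc, h c ⟨hc, fun b hb => hmax b hb trivial⟩, fun b hb hbd => ?_⟩
      have h1 := hmax b hb trivial
      by_contra h2
      exact h b ⟨hb, fun b' hb' => (hmax b' hb' trivial).trans (by omega)⟩ hbd
    · rintro ⟨g, hg, hgd, h⟩ c ⟨hc, hmax⟩ hcd
      have h1 := h c hc hcd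
      have h2 := hmax g hg
      omega

/-! ### Affordable sets of bribes and the greedy choice. -/

/-- `Sel k l spent X Y`: some of the voters with the prices and weights `l` can be bribed without
exceeding the limit `k`, such that `X` is the weight of the bribed voters and `Y` is the weight of
the others. -/
inductive Sel (k : ℕ) : List (ℕ × ℕ) → ℕ → ℕ → ℕ → Prop
  | nil {s} : Sel k [] s 0 0
  | skip {l s X Y p w} : Sel k l s X Y → Sel k ((p, w) :: l) s X (Y + w)
  | take {l s X Y p w} : s + p ≤ k → Sel k l (s + p) X Y → Sel k ((p, w) :: l) s (X + w) Y

theorem Sel.mono {k l s X Y} (h : Sel k l s X Y) {s' : ℕ} (hs : s' ≤ s) : Sel k l s' X Y := by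
  induction h generalizing s' with
  | nil => exact .nil
  | skip _ ih => exact .skip (ih hs)
  | take hk _ ih => exact .take (by omega) (ih (by omega))

theorem Sel.total {k l s X Y} (h : Sel k l s X Y) : X + Y = (l.map Prod.snd).sum := by
  induction h with
  | nil => rfl
  | skip _ ih => simp; omega
  | take _ _ ih => simp; omega

/-- Affordability of a set of bribes depends only on its total price. This permits sorting the
voters although they vote in a prescribed order. -/
theorem Sel.perm {k l l'} (hl : l.Perm l') {s X Y} (h : Sel k l s X Y) : Sel k l' s X Y := by
  induction hl generalizing s X Y with
  | nil => exact h
  | cons a _ ih =>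
    cases h with
    | skip h => exact .skip (ih h)
    | take hk h => exact .take hk (ih h)
  | swap a b l =>
    cases h with
    | skip h =>
      cases h with
      | skip h =>
        rw [Nat.add_right_comm]
        exact .skip (.skip h)
      | take hk h => exact .take hk (.skip h)
    | take hk h =>
      cases h with
      | skip h => exact .skip (.take hk h)
      | take hk' h =>
        rw [Nat.add_right_comm] at h ⊢
        exact .take (by omega) (.take (by omega) h)
  | trans _ _ ih ih' => exact ih' (ih h)

/-- `Better a b`: the voter `a` is not more expensive and not of less weight than `b`. -/
def Better (a b : ℕ × ℕ) : Prop := a.1 ≤ b.1 ∧ b.2 ≤ a.2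

/-- Give up the first bribed voter. It costs at least as much as `a`, so the others remain
affordable after paying for `a`, and the weight lost is at most that of `a`. If nobody is bribed,
`X` is 0. -/
theorem Sel.exchange {k l s X Y} (h : Sel k l s X Y) {a : ℕ × ℕ} (hl : ∀ b ∈ l, Better a b)
    (ha : s + a.1 ≤ k) : ∃ X' Y', Sel k l (s + a.1) X' Y' ∧ X ≤ X' + a.2 := by
  induction h with
  | nil => exact ⟨0, 0, .nil, by omega⟩
  | skip _ ih =>
    obtain ⟨X', Y', h', hX⟩ := ih (fun b hb => hl b (List.mem_cons_of_mem _ hb)) ha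
    exact ⟨X', _, .skip h', hX⟩
  | @take l s X Y p w hk h ih =>
    obtain ⟨h1, h2⟩ := hl _ List.mem_cons_self
    exact ⟨X, _, .skip (h.mono (by simpa using h1)), by simpa using h2⟩

/-- Bribe the voters in the given order as long as this is possible; the result is the weight of the
bribed voters and the weight of the others. -/
def greedy (k : ℕ) : List (ℕ × ℕ) → ℕ → ℕ × ℕ
  | [], _ => (0, 0)
  | (p, w) :: l, s =>
    if s + p ≤ k then ((greedy k l (s + p)).1 + w, (greedy k l (s + p)).2)
    else ((greedy k l s).1, (greedy k l s).2 + w)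

theorem sel_greedy (k : ℕ) (l : List (ℕ × ℕ)) (s : ℕ) :
    Sel k l s (greedy k l s).1 (greedy k l s).2 := by
  induction l generalizing s with
  | nil => exact .nil
  | cons a l ih =>
    unfold greedy
    split_ifs with h
    · exact .take h (ih _)
    · exact .skip (ih _)

/-- The greedy choice differs from a selection at the head only by bribing a voter that the
selection skips, and `Sel.exchange` turns this into a selection from the tail. -/
theorem Sel.le_greedy {k l s X Y} (h : Sel k l s X Y) (hl : l.Pairwise Better) :
    X ≤ (greedy k l s).1 := by
  induction l generalizing s X Y with
  | nil => cases h; exact le_rfl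
  | cons a l ih =>
    rw [List.pairwise_cons] at hl
    cases h with
    | @skip _ _ _ Y p w h =>
      unfold greedy
      split_ifs with hk
      · obtain ⟨X', Y', h', hX⟩ := h.exchange hl.1 hk
        exact hX.trans (Nat.add_le_add_right (ih h' hl.2) _)
      · exact ih h hl.2
    | @take _ _ X _ p w hk h =>
      unfold greedy
      rw [if_pos hk]
      exact Nat.add_le_add_right (ih h hl.2) _

/-! ### From the online game to selections of voters. -/

/-- The price and the weight of a voter. -/
def FutureVoter.data {p w : Bool} (v : FutureVoter p w) : ℕ × ℕ := (v.price.value, v.weight.value)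

theorem exists_isPref {C : List Name} {c : Name} (hc : c ∈ C) :
    ∃ τ, IsPref C τ ∧ τ.head? = some c := by
  exact ⟨c :: C.erase c, (List.perm_cons_erase hc).symm, rfl⟩

theorem IsPref.head?_eq {C : List Name} {τ : Pref} (h : IsPref C τ) (hC : C ≠ []) :
    ∃ c ∈ C, τ.head? = some c := by
  cases τ with
  | nil => exact absurd (List.Perm.eq_nil h.symm) hC
  | cons c τ => exact ⟨c, h.subset List.mem_cons_self, rfl⟩

theorem top_cast {p w : Bool} (v : FutureVoter p w) (τ : Pref) :
    (v.cast τ).top = (τ.head?, v.weight.value) := rfl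

/-- If the briber can force the goal, play against the adversary who reveals a vote for a strongest
bad candidate: an unbribed voter then raises the maximum bad score by its full weight, and a bribed
one helps `g` by at most its weight. Conversely, fix the selection and `g` in advance and bribe the
selected voters to vote for `g`; any other vote raises a bad candidate by at most its weight. -/
theorem canForce_iff {p w : Bool} {C : List Name} (hC : C ≠ []) (k : ℕ) (G : Name → Bool) (m : ℕ)
    (F : List (FutureVoter p w)) (spent : ℕ) (U : List WeightedVote) :
    CanForce C k (fun U => Leads C G (topScore (U.map WeightedVote.top)) m 0) F spent U ↔
      ∃ X Y, Sel k (F.map FutureVoter.data) spent X Y ∧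
        Leads C G (topScore (U.map WeightedVote.top)) (Y + m) X := by
  induction F generalizing spent U with
  | nil =>
    constructor
    · intro h
      exact ⟨0, 0, .nil, by simpa [CanForce] using h⟩
    · rintro ⟨X, Y, h, hl⟩
      cases h
      simpa [CanForce] using hl
  | cons v F ih =>
    simp only [CanForce, Decide, ih, List.map_append, List.map_cons, List.map_nil, top_cast]
    generalize topScore_append (U.map WeightedVote.top) = hs
    constructor
    · intro h
      -- That `b₀` is bad is claimed only if some bad `b` exists; otherwise any candidate serves.
      obtain ⟨b₀, hb₀, hmax⟩ : ∃ b₀ ∈ C, ∀ b ∈ C, G b = false → G b₀ = false ∧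
          topScore (U.map WeightedVote.top) b ≤ topScore (U.map WeightedVote.top) b₀ := by
        by_cases hB : ∃ b ∈ C, G b = false
        · obtain ⟨b₀, hb₀, hb₁, h⟩ := exists_max_score (fun b => G b = false)
            (topScore (U.map WeightedVote.top)) hB
          exact ⟨b₀, hb₀, fun b hb hb' => ⟨hb₁, h b hb hb'⟩⟩
        · obtain ⟨b₀, hb₀⟩ := List.exists_mem_of_ne_nil C hC
          exact ⟨b₀, hb₀, fun b hb hb' => absurd ⟨b, hb, hb'⟩ hB⟩
      obtain ⟨σ, hσ, hσ'⟩ := exists_isPref hb₀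
      rcases h σ hσ with ⟨X, Y, hsel, g, hg, hgG, hl⟩ | ⟨hk, τ, hτ, X, Y, hsel, g, hg, hgG, hl⟩
      · refine ⟨X, Y + v.weight.value, .skip hsel, g, hg, hgG, fun b hb hbG => ?_⟩
        obtain ⟨h1, h2⟩ := hmax b hb hbG
        have h3 := hl b₀ hb₀ h1
        have h4 : b₀ ≠ g := by rintro rfl; rw [h1] at hgG; cases hgG
        rw [hs, hs, hσ', if_pos rfl, if_neg (by simpa using h4)] at h3
        omega
      · refine ⟨X + v.weight.value, Y, .take hk hsel, g, hg, hgG, fun b hb hbG => ?_⟩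
        have h3 := hl b hb hbG
        rw [hs, hs] at h3
        split_ifs at h3 <;> omega
    · rintro ⟨X, Y, hsel, g, hg, hgG, hl⟩ σ -
      cases hsel with
      | @skip _ _ _ Y _ _ hsel =>
        refine .inl ⟨X, Y, hsel, g, hg, hgG, fun b hb hbG => ?_⟩
        have h3 := hl b hb hbG
        rw [hs, hs]
        split_ifs <;> omega
      | @take _ _ X _ _ _ hk hsel =>
        obtain ⟨τ, hτ, hτ'⟩ := exists_isPref hg
        refine .inr ⟨hk, τ, hτ, X, Y, hsel, g, hg, hgG, fun b hb hbG => ?_⟩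
        have h3 := hl b hb hbG
        have h4 : g ≠ b := by rintro rfl; rw [hbG] at hgG; cases hgG
        rw [hs, hs, hτ', if_pos rfl, if_neg (by simpa using h4)]
        omega

/-- The briber can enforce the goal from a situation given by first choices. -/
def Forces (C : List Name) (G : Name → Bool) (m k : ℕ) (l : List (ℕ × ℕ)) (spent : ℕ)
    (V : List (Option Name × ℕ)) : Prop :=
  Leads C G (topScore V) ((greedy k l spent).2 + m) (greedy k l spent).1

/-- The weights `X` and `Y` have a fixed sum, so the selection of largest `X` also has the smallest
`Y`, and it suffices to test the greedy one. -/
theorem canForce_iff_forces {p w : Bool} {C : List Name} (hC : C ≠ []) (k : ℕ) (G : Name → Bool)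
    (m : ℕ) (F : List (FutureVoter p w)) (spent : ℕ) (U : List WeightedVote) {l : List (ℕ × ℕ)}
    (hl : l.Perm (F.map FutureVoter.data)) (hl' : l.Pairwise Better) :
    CanForce C k (fun U => Leads C G (topScore (U.map WeightedVote.top)) m 0) F spent U ↔
      Forces C G m k l spent (U.map WeightedVote.top) := by
  rw [canForce_iff hC]
  constructor
  · rintro ⟨X, Y, hsel, g, hg, hgG, h⟩
    have h1 := hsel.perm hl.symm
    have h2 := h1.le_greedy hl'
    have h3 := h1.total
    have h4 := (sel_greedy k l spent).total
    refine ⟨g, hg, hgG, fun b hb hbG => ?_⟩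
    have := h b hb hbG
    omega
  · intro h
    exact ⟨_, _, (sel_greedy k l spent).perm hl, h⟩

/-- Only the first choice in a bribed vote matters, so the search for the decision on the current
voter runs over candidates instead of over all orders. -/
theorem succeeds_iff {p w : Bool} (I : OBS p w) (hI : I.WellFormed) (v : Version)
    {l : List (ℕ × ℕ)} (hl : l.Perm (I.future.map FutureVoter.data)) (hl' : l.Pairwise Better) :
    I.Succeeds plurality v ↔ I.spent ≤ I.k ∧
      (Forces I.candidates (v.good I.briber I.d) v.lead I.k l I.spent
        (I.castVotes.map WeightedVote.top ++ [(I.current.vote.head?, I.current.weight.value)]) ∨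
      I.spent + I.current.price.value ≤ I.k ∧ ∃ t ∈ I.candidates,
        Forces I.candidates (v.good I.briber I.d) v.lead I.k l (I.spent + I.current.price.value)
          (I.castVotes.map WeightedVote.top ++ [(some t, I.current.weight.value)])) := by
  have hC : I.candidates ≠ [] := List.ne_nil_of_mem hI.mem
  have hg : (fun U => I.Goal plurality U v) = fun U => Leads I.candidates (v.good I.briber I.d)
      (topScore (U.map WeightedVote.top)) v.lead 0 :=
    funext fun U => propext (goal_iff I hI.mem U v)
  unfold OBS.Succeeds Decide
  rw [hg]
  simp only [canForce_iff_forces hC _ _ _ _ _ _ hl hl', List.map_append, List.map_cons,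
    List.map_nil, top_cast]
  refine and_congr_right fun _ => or_congr_right (and_congr_right fun _ => ?_)
  constructor
  · rintro ⟨τ, hτ, h⟩
    obtain ⟨c, hc, hc'⟩ := hτ.head?_eq hC
    rw [hc'] at h
    exact ⟨c, hc, h⟩
  · rintro ⟨t, ht, h⟩
    obtain ⟨τ, hτ, hτ'⟩ := exists_isPref ht
    exact ⟨τ, hτ, by rwa [hτ']⟩

end Election

/-! ### Encoding and decoding of online bribery settings -/

namespace PolyTime

open Function Enc
open Computability (Γ')
open Election

variable {α β γ δ : Type} [Enc α] [Enc β] [Enc γ] [Enc δ]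

@[fun_prop]
theorem Poly.symBits {f : α → Γ'} (hf : Poly f) : Poly fun a => symBits (f a) :=
  (Poly.of_toD (f := PolyTime.symBits) _ .id fun _ => rfl).comp hf

@[fun_prop]
theorem Poly.bit {f : α → Bool} (hf : Poly f) : Poly fun a => Γ'.bit (f a) :=
  (Poly.of_eq_toD (f := Γ'.bit) (g := fun b : Bool => (true, false, b)) (by fun_prop)
    fun _ => rfl).comp hf

instance [PolyEq β] : PolyEq (Option β) := by
  refine .of_injective Option.toList (.of_toD _ .id fun o => by cases o <;> rfl) fun a b h => ?_
  cases a <;> cases b <;> simp_all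

/-! #### Data types of the problem -/

instance instEncOptNat : (b : Bool) → Enc (OptNat b)
  | true => inferInstanceAs (Enc ℕ)
  | false => inferInstanceAs (Enc Unit)

@[fun_prop]
theorem Poly.value {b : Bool} {f : α → OptNat b} (hf : Poly f) : Poly fun a => (f a).value := by
  cases b
  · exact .const 1
  · exact hf

variable {p w : Bool}

instance : Enc (FutureVoter p w) := ⟨fun v => toD (v.name, v.price, v.weight)⟩

instance : Enc (CurrentVoter p w) := ⟨fun v => toD (v.toFutureVoter, v.vote)⟩

instance : Enc (PastVoter p w) := ⟨fun v => toD (v.toCurrentVoter, v.bribed)⟩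

instance : Enc (OBS p w) :=
  ⟨fun I => toD (I.candidates, I.past, I.current, I.future, I.briber, I.d, I.k)⟩

theorem Poly.futureTuple : Poly fun v : FutureVoter p w => (v.name, v.price, v.weight) :=
  .of_toD _ .id fun _ => rfl

theorem Poly.currentTuple : Poly fun v : CurrentVoter p w => (v.toFutureVoter, v.vote) :=
  .of_toD _ .id fun _ => rfl

theorem Poly.pastTuple : Poly fun v : PastVoter p w => (v.toCurrentVoter, v.bribed) :=
  .of_toD _ .id fun _ => rfl

theorem Poly.obsTuple : Poly fun I : OBS p w =>
    (I.candidates, I.past, I.current, I.future, I.briber, I.d, I.k) :=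
  .of_toD _ .id fun _ => rfl

@[fun_prop]
theorem Poly.name : Poly fun v : FutureVoter p w => v.name :=
  Poly.comp (g := fun t : ℕ × OptNat p × OptNat w => t.1) (by fun_prop) .futureTuple

@[fun_prop]
theorem Poly.price : Poly fun v : FutureVoter p w => v.price :=
  Poly.comp (g := fun t : ℕ × OptNat p × OptNat w => t.2.1) (by fun_prop) .futureTuple

@[fun_prop]
theorem Poly.weight : Poly fun v : FutureVoter p w => v.weight :=
  Poly.comp (g := fun t : ℕ × OptNat p × OptNat w => t.2.2) (by fun_prop) .futureTuple

@[fun_prop]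
theorem Poly.toFutureVoter {f : α → CurrentVoter p w} (hf : Poly f) : Poly fun a => (f a).toFutureVoter :=
  (Poly.comp (g := fun t : FutureVoter p w × Pref => t.1) (by fun_prop) .currentTuple).comp hf

@[fun_prop]
theorem Poly.vote : Poly fun v : CurrentVoter p w => v.vote :=
  Poly.comp (g := fun t : FutureVoter p w × Pref => t.2) (by fun_prop) .currentTuple

@[fun_prop]
theorem Poly.toCurrentVoter {f : α → PastVoter p w} (hf : Poly f) : Poly fun a => (f a).toCurrentVoter :=
  (Poly.comp (g := fun t : CurrentVoter p w × Bool => t.1) (by fun_prop) .pastTuple).comp hf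

@[fun_prop]
theorem Poly.bribed : Poly fun v : PastVoter p w => v.bribed :=
  Poly.comp (g := fun t : CurrentVoter p w × Bool => t.2) (by fun_prop) .pastTuple

/-- The components of a setting. -/
abbrev ObsTuple (p w : Bool) : Type := List Name × List (PastVoter p w) × CurrentVoter p w ×
  List (FutureVoter p w) × Pref × Name × ℕ

@[fun_prop]
theorem Poly.candidates : Poly fun I : OBS p w => I.candidates :=
  Poly.comp (g := fun t : ObsTuple p w => t.1) (by fun_prop) .obsTuple

@[fun_prop]
theorem Poly.past : Poly fun I : OBS p w => I.past :=
  Poly.comp (g := fun t : ObsTuple p w => t.2.1) (by fun_prop) .obsTuple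

@[fun_prop]
theorem Poly.current {f : α → OBS p w} (hf : Poly f) : Poly fun a => (f a).current :=
  (Poly.comp (g := fun t : ObsTuple p w => t.2.2.1) (by fun_prop) .obsTuple).comp hf

@[fun_prop]
theorem Poly.future : Poly fun I : OBS p w => I.future :=
  Poly.comp (g := fun t : ObsTuple p w => t.2.2.2.1) (by fun_prop) .obsTuple

@[fun_prop]
theorem Poly.briber : Poly fun I : OBS p w => I.briber :=
  Poly.comp (g := fun t : ObsTuple p w => t.2.2.2.2.1) (by fun_prop) .obsTuple

@[fun_prop]
theorem Poly.d : Poly fun I : OBS p w => I.d :=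
  Poly.comp (g := fun t : ObsTuple p w => t.2.2.2.2.2.1) (by fun_prop) .obsTuple

@[fun_prop]
theorem Poly.k : Poly fun I : OBS p w => I.k :=
  Poly.comp (g := fun t : ObsTuple p w => t.2.2.2.2.2.2) (by fun_prop) .obsTuple

/-! #### Encoding -/

@[fun_prop]
theorem Poly.encNat {f : α → ℕ} (hf : Poly f) : Poly fun a => encNat (f a) := by
  unfold Election.encNat
  fun_prop

omit [Enc β] in
theorem encList_eq (e : β → List Γ') (l : List β) :
    encList e l = (l.flatMap fun b => Γ'.bra :: e b) ++ [Γ'.ket] := by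
  induction l with
  | nil => rfl
  | cons b l ih => simp [encList, ih]

@[fun_prop]
theorem Poly.encList {e : β → List Γ'} (he : Poly e) {l : α → List β} (hl : Poly l) :
    Poly fun a => encList e (l a) := by
  simp only [encList_eq]
  fun_prop

@[fun_prop]
theorem Poly.encOptNat {b : Bool} {f : α → OptNat b} (hf : Poly f) :
    Poly fun a => encOptNat (f a) := by
  cases b
  · exact .const []
  · exact Poly.encNat hf

@[fun_prop]
theorem Poly.futureEnc : Poly (FutureVoter.enc (p := p) (w := w)) := by
  unfold FutureVoter.enc
  fun_prop

@[fun_prop]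
theorem Poly.currentEnc : Poly (CurrentVoter.enc (p := p) (w := w)) := by
  unfold CurrentVoter.enc
  fun_prop

@[fun_prop]
theorem Poly.pastEnc : Poly (PastVoter.enc (p := p) (w := w)) := by
  unfold PastVoter.enc
  fun_prop

@[fun_prop]
theorem Poly.obsEnc : Poly (OBS.enc (p := p) (w := w)) := by
  unfold OBS.enc
  fun_prop

/-! #### Decoding -/

/-- `p` reads an object in the code `e` from the beginning of a string, in polynomial time. -/
structure IsParser (e : α → List Γ') (p : List Γ' → α × List Γ') : Prop where
  poly : Poly p
  size_le : ∀ x, size (p x).2 ≤ size x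
  parse : ∀ a x, p (e a ++ x) = (a, x)

/-- Whether a symbol is a binary digit. -/
def isBit (a : Γ') : Bool := (symBits a).1 && !(symBits a).2.1

@[fun_prop]
theorem Poly.isBit {f : α → Γ'} (hf : Poly f) : Poly fun a => isBit (f a) := by
  unfold PolyTime.isBit
  fun_prop

/-- Read a number. -/
def parseNat (x : List Γ') : ℕ × List Γ' :=
  (ofBits ((x.takeWhile isBit).map fun a => (symBits a).2.2), (x.dropWhile isBit).tail)

theorem size_dropWhile_le (f : α → Bool) (l : List α) : size (l.dropWhile f) ≤ size l := by
  induction l with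
  | nil => exact le_rfl
  | cons a l ih =>
    rw [List.dropWhile_cons]
    split_ifs
    · rw [size_cons]; omega
    · exact le_rfl

theorem isParser_nat : IsParser encNat parseNat where
  poly := by
    unfold parseNat
    fun_prop
  size_le x := (size_tail_le _).trans (size_dropWhile_le _ _)
  parse n x := by
    have h1 : ∀ l : List Bool, ((l.map Γ'.bit ++ [Γ'.comma]) ++ x).takeWhile isBit =
        l.map Γ'.bit := by
      intro l
      induction l with
      | nil => rfl
      | cons b l ih => simpa [List.takeWhile_cons, isBit, symBits] using ih
    have h2 : ∀ l : List Bool, ((l.map Γ'.bit ++ [Γ'.comma]) ++ x).dropWhile isBit =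
        Γ'.comma :: x := by
      intro l
      induction l with
      | nil => rfl
      | cons b l ih => simpa [List.dropWhile_cons, isBit, symBits] using ih
    unfold parseNat encNat
    rw [h1, h2, List.map_map]
    have : ((fun a => (symBits a).2.2) ∘ Γ'.bit) = fun b => b := rfl
    rw [this, List.map_id', ofBits_encodeNat]; rfl

theorem IsParser.pair {e : α → List Γ'} {e' : β → List Γ'} {p : List Γ' → α × List Γ'}
    {q : List Γ' → β × List Γ'} (hp : IsParser e p) (hq : IsParser e' q) :
    IsParser (fun a : α × β => e a.1 ++ e' a.2)
      fun x => (((p x).1, (q (p x).2).1), (q (p x).2).2) where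
  poly := by
    have h1 := hp.poly
    have h2 := hq.poly
    fun_prop
  size_le x := (hq.size_le _).trans (hp.size_le _)
  parse a x := by simp [hp.parse, hq.parse]

theorem IsParser.map {e : α → List Γ'} {p : List Γ' → α × List Γ'} (hp : IsParser e p)
    {e' : β → List Γ'} {f : α → β} (hf : Poly f) (g : β → α) (hg : ∀ b, f (g b) = b)
    (he : ∀ b, e' b = e (g b)) : IsParser e' fun x => (f (p x).1, (p x).2) where
  poly := by
    have h1 := hp.poly
    fun_prop
  size_le x := hp.size_le x
  parse a x := by rw [he, hp.parse, hg]

/-- One step of reading a list: the first component tells whether the list has been read. -/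
def listStep (p : List Γ' → α × List Γ') (s : Bool × List α × List Γ') : Bool × List α × List Γ' :=
  bif s.1 then s else
    bif decide (s.2.2.head? = some Γ'.bra) then
      (false, (p s.2.2.tail).1 :: s.2.1, (p s.2.2.tail).2)
    else (true, s.2.1, s.2.2.tail)

/-- Read a list. -/
def parseList (p : List Γ' → α × List Γ') (x : List Γ') : List α × List Γ' :=
  (fun s : Bool × List α × List Γ' => (s.2.1.reverse, s.2.2))
    (x.foldl (fun s _ => listStep p s) (false, [], x))

/-- The input string itself counts the steps. On malformed strings the size bounds must hold too:
the rest never grows, so every entry read has size polynomial in the original input. -/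
theorem IsParser.list {e : α → List Γ'} {p : List Γ' → α × List Γ'} (hp : IsParser e p) :
    IsParser (encList e) (parseList p) := by
  have hpp := hp.poly
  obtain ⟨q, hq⟩ := hpp.size_le
  have hstep : ∀ (s : Bool × List α × List Γ') (n : ℕ), size s.2.2 ≤ n →
      size (listStep p s).2.2 ≤ n ∧ size (listStep p s).2.1 ≤ size s.2.1 + (q.eval n + 1) := by
    rintro ⟨b, acc, r⟩ n hn
    unfold listStep
    cases b with
    | true => exact ⟨hn, by simp⟩
    | false =>
      have h1 := size_tail_le r
      have h2 := hp.size_le r.tail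
      have h3 := hq r.tail
      rw [← Prod.mk.eta (p := p r.tail), size_pair] at h3
      have h4 := eval_mono q (show size r.tail ≤ n from h1.trans hn)
      cases decide (r.head? = some Γ'.bra) with
      | true =>
        simp only [cond_false, cond_true, size_cons]
        simp only at hn
        constructor <;> omega
      | false =>
        simp only [cond_false]
        exact ⟨h1.trans hn, by omega⟩
  have hfold : ∀ (l : List Γ') (s : Bool × List α × List Γ') (n : ℕ), size s.2.2 ≤ n →
      size (l.foldl (fun s _ => listStep p s) s).2.2 ≤ n ∧
      size (l.foldl (fun s _ => listStep p s) s).2.1 ≤ size s.2.1 + l.length * (q.eval n + 1) := by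
    intro l
    induction l with
    | nil => intro s n hs; simpa using hs
    | cons a l ih =>
      intro s n hs
      obtain ⟨h1, h2⟩ := hstep s n hs
      obtain ⟨h3, h4⟩ := ih _ n h1
      refine ⟨h3, ?_⟩
      rw [List.foldl_cons, List.length_cons, Nat.add_mul]
      omega
  refine ⟨?_, fun x => (hfold x _ _ le_rfl).1, fun l x => ?_⟩
  · have hs : Poly fun s : Bool × List α × List Γ' => listStep p s := by
      unfold listStep
      fun_prop
    refine Poly.comp (g := fun s : Bool × List α × List Γ' => (s.2.1.reverse, s.2.2))
      (by fun_prop) <| Poly.foldl (s := fun _ s _ => listStep p s)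
      (i := fun x => (false, [], x)) (l := fun x => x) (by fun_prop) (by fun_prop) (by fun_prop)
      -- The 8 accounts for the flag (5), the two pairing nodes (2) and the empty list (1).
      (8 + Polynomial.X + Polynomial.X * (q + 1)) fun x l' hl => ?_
    obtain ⟨h1, h2⟩ := hfold l' (false, [], x) (size x) le_rfl
    rw [← Prod.mk.eta (p := l'.foldl (fun s _ => listStep p s) (false, [], x)),
      ← Prod.mk.eta (p := (l'.foldl (fun s _ => listStep p s) (false, [], x)).2),
      size_pair, size_pair, size_bool]
    have h3 := Nat.mul_le_mul_right (q.eval (size x) + 1)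
      (hl.length_le.trans (length_le_size x))
    simp only [size_nil] at h2
    simp only [Polynomial.eval_add, Polynomial.eval_mul, Polynomial.eval_X, Polynomial.eval_one,
      Polynomial.eval_ofNat]
    omega
  · have hdone : ∀ (m : List Γ') (acc : List α),
        m.foldl (fun s _ => listStep p s) (true, acc, x) = (true, acc, x) := by
      intro m acc
      induction m with
      | nil => rfl
      | cons a m ih => exact ih
    have key : ∀ (l : List α) (m : List Γ') (acc : List α), l.length < m.length →
        m.foldl (fun s _ => listStep p s) (false, acc, encList e l ++ x) =
          (true, l.reverse ++ acc, x) := by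
      intro l
      induction l with
      | nil =>
        intro m acc hm
        cases m with
        | nil => simp at hm
        | cons a m => exact hdone m acc
      | cons b l ih =>
        intro m acc hm
        cases m with
        | nil => simp at hm
        | cons a m =>
          have h1 : listStep p (false, acc, encList e (b :: l) ++ x) =
              (false, b :: acc, encList e l ++ x) := by
            simp [listStep, encList, hp.parse]
          rw [List.foldl_cons, h1, ih m _ (by simpa using hm)]
          simp
    -- One step is needed for each entry and one for the closing `ket`, hence the strict inequality.
    have hlen : ∀ l : List α, l.length < (encList e l).length := by
      intro l
      induction l with
      | nil => simp [encList]
      | cons a l ih => simp [encList]; omega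
    unfold parseList
    rw [key l _ _ (by rw [List.length_append]; have := hlen l; omega)]
    simp

theorem exists_parser_optNat (b : Bool) :
    ∃ q : List Γ' → OptNat b × List Γ', IsParser encOptNat q := by
  cases b
  · exact ⟨fun x => ((), x), ⟨(Poly.const ()).pair .id, fun x => le_rfl, fun _ _ => rfl⟩⟩
  · exact ⟨_, isParser_nat⟩

theorem exists_parser_future :
    ∃ q, IsParser (FutureVoter.enc (p := p) (w := w)) q := by
  obtain ⟨q, hq⟩ := exists_parser_optNat p
  obtain ⟨r, hr⟩ := exists_parser_optNat w
  exact ⟨_, (isParser_nat.pair (hq.pair hr)).map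
    (f := fun t : ℕ × OptNat p × OptNat w => (⟨t.1, t.2.1, t.2.2⟩ : FutureVoter p w))
    (.of_toD _ .id fun _ => rfl) (fun v => (v.name, v.price, v.weight)) (fun _ => rfl)
    fun _ => rfl⟩

theorem exists_parser_current :
    ∃ q, IsParser (CurrentVoter.enc (p := p) (w := w)) q := by
  obtain ⟨q, hq⟩ := exists_parser_future (p := p) (w := w)
  exact ⟨_, (hq.pair isParser_nat.list).map
    (f := fun t : FutureVoter p w × Pref => (⟨t.1, t.2⟩ : CurrentVoter p w))
    (.of_toD _ .id fun _ => rfl) (fun v => (v.toFutureVoter, v.vote)) (fun _ => rfl)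
    fun _ => rfl⟩

theorem isParser_bit : IsParser (fun b => [Γ'.bit b])
    (fun x => (decide (x.head? = some (Γ'.bit true)), x.tail)) where
  poly := by fun_prop
  size_le x := size_tail_le x
  parse b x := by cases b <;> simp

theorem exists_parser_past :
    ∃ q, IsParser (PastVoter.enc (p := p) (w := w)) q := by
  obtain ⟨q, hq⟩ := exists_parser_current (p := p) (w := w)
  exact ⟨_, (hq.pair isParser_bit).map
    (f := fun t : CurrentVoter p w × Bool => (⟨t.1, t.2⟩ : PastVoter p w))
    (.of_toD _ .id fun _ => rfl) (fun v => (v.toCurrentVoter, v.bribed)) (fun _ => rfl)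
    fun _ => rfl⟩

theorem exists_parser_obs : ∃ q, IsParser (OBS.enc (p := p) (w := w)) q := by
  obtain ⟨q₁, h₁⟩ := exists_parser_past (p := p) (w := w)
  obtain ⟨q₂, h₂⟩ := exists_parser_current (p := p) (w := w)
  obtain ⟨q₃, h₃⟩ := exists_parser_future (p := p) (w := w)
  exact ⟨_, (isParser_nat.list.pair <| h₁.list.pair <| h₂.pair <| h₃.list.pair <|
    isParser_nat.list.pair <| isParser_nat.pair isParser_nat).map
    (f := fun t : ObsTuple p w => (⟨t.1, t.2.1, t.2.2.1, t.2.2.2.1, t.2.2.2.2.1, t.2.2.2.2.2.1,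
      t.2.2.2.2.2.2⟩ : OBS p w))
    (.of_toD _ .id fun _ => rfl)
    (fun I => (I.candidates, I.past, I.current, I.future, I.briber, I.d, I.k)) (fun _ => rfl)
    fun _ => rfl⟩

/-- A language of strings that encode settings with some property is in P if the property is
decided in polynomial time. -/
theorem inP_of_poly_obs (P : OBS p w → Prop) (f : OBS p w → Bool) (hf : Poly f)
    (hP : ∀ I, f I = true ↔ P I) : InP {x : List Γ' | ∃ I : OBS p w, P I ∧ I.enc = x} := by
  obtain ⟨q, hq⟩ := exists_parser_obs (p := p) (w := w)
  have hqp := hq.poly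
  -- The parser returns some setting on every string; encoding it again detects whether the string
  -- was a valid code.
  refine inP_of_poly (fun x => decide ((q x).1.enc = x) && f (q x).1) (by fun_prop) fun x => ?_
  rw [Bool.and_eq_true, decide_eq_true_iff, hP]
  constructor
  · rintro ⟨h1, h2⟩
    exact ⟨_, h2, h1⟩
  · rintro ⟨I, hI, rfl⟩
    have : q I.enc = (I, []) := by simpa using hq.parse I []
    rw [this]
    exact ⟨rfl, hI⟩

end PolyTime

/-! ### Deciding online bribery for plurality -/

namespace PolyTime

open Function Enc
open Computability (Γ')
open Election

variable {α β γ δ : Type} [Enc α] [Enc β] [Enc γ] [Enc δ]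

theorem idxOf_eq (σ : List ℕ) (c : ℕ) :
    σ.idxOf c = (σ.takeWhile fun x => !decide (x = c)).length := by
  induction σ with
  | nil => rfl
  | cons x σ ih => by_cases h : x = c <;> simp [h, ih]

@[fun_prop]
theorem Poly.idxOf {σ : α → List ℕ} {c : α → ℕ} (hσ : Poly σ) (hc : Poly c) :
    Poly fun a => (σ a).idxOf (c a) := by
  simp only [idxOf_eq]
  fun_prop

@[fun_prop]
theorem Poly.good (v : Version) {σ : α → Pref} {d c : α → ℕ} (hσ : Poly σ) (hd : Poly d)
    (hc : Poly c) : Poly fun a => v.good (σ a) (d a) (c a) := by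
  cases v <;> simp only [Version.good] <;> fun_prop

@[fun_prop]
theorem Poly.topScore {V : α → List (Option ℕ × ℕ)} {c : α → ℕ} (hV : Poly V) (hc : Poly c) :
    Poly fun a => topScore (V a) (c a) := by
  unfold Election.topScore
  fun_prop

/-! #### Sorting voters -/

/-- A decision function for `Better`. -/
def better (a b : ℕ × ℕ) : Bool := decide (a.1 ≤ b.1) && decide (b.2 ≤ a.2)

theorem better_iff {a b : ℕ × ℕ} : better a b = true ↔ Better a b := by simp [better, Better]

@[fun_prop]
theorem Poly.better {f g : α → ℕ × ℕ} (hf : Poly f) (hg : Poly g) :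
    Poly fun a => better (f a) (g a) := by
  unfold PolyTime.better
  fun_prop

/-- Insert a voter before all those that are not better. -/
def insertVoter (l : List (ℕ × ℕ)) (a : ℕ × ℕ) : List (ℕ × ℕ) :=
  (l.filter fun b => !better a b) ++ a :: l.filter fun b => better a b

/-- Sort voters such that better ones come first. -/
def sortVoters (l : List (ℕ × ℕ)) : List (ℕ × ℕ) := l.foldl insertVoter []

theorem insertVoter_perm (l : List (ℕ × ℕ)) (a : ℕ × ℕ) : (insertVoter l a).Perm (a :: l) := by
  unfold insertVoter
  refine List.perm_middle.trans (.cons a ?_)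
  refine List.perm_append_comm.trans ?_
  exact List.filter_append_perm (fun b => better a b) l

theorem sortVoters_perm (l : List (ℕ × ℕ)) : (sortVoters l).Perm l := by
  have key : ∀ l m : List (ℕ × ℕ), (l.foldl insertVoter m).Perm (l ++ m) := by
    intro l
    induction l with
    | nil => intro m; exact .refl _
    | cons a l ih =>
      intro m
      exact (ih _).trans (((insertVoter_perm m a).append_left l).trans List.perm_middle)
  simpa [sortVoters] using key l []

/-- Comparability of all voters is essential: those for which `better a` fails are put before `a`,
which is correct only if they are better than `a`. -/
theorem sortVoters_pairwise {l : List (ℕ × ℕ)}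
    (hl : ∀ a ∈ l, ∀ b ∈ l, Better a b ∨ Better b a) : (sortVoters l).Pairwise Better := by
  have htrans : ∀ {a b c : ℕ × ℕ}, Better a b → Better b c → Better a c :=
    fun h h' => ⟨h.1.trans h'.1, h'.2.trans h.2⟩
  have key : ∀ l' m : List (ℕ × ℕ), (∀ a ∈ l', a ∈ l) → (∀ a ∈ m, a ∈ l) → m.Pairwise Better →
      (l'.foldl insertVoter m).Pairwise Better := by
    intro l'
    induction l' with
    | nil => intro m _ _ h; exact h
    | cons a l' ih =>
      intro m h1 h2 h3
      refine ih _ (fun b hb => h1 b (List.mem_cons_of_mem _ hb)) (fun b hb => ?_) ?_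
      · rcases List.mem_cons.1 ((insertVoter_perm m a).subset hb) with rfl | hb
        · exact h1 _ List.mem_cons_self
        · exact h2 b hb
      · have ha := h1 a List.mem_cons_self
        have h4 : ∀ b ∈ m.filter (fun b => !better a b), Better b a := by
          intro b hb
          simp only [List.mem_filter, Bool.not_eq_true', ← Bool.not_eq_true, better_iff] at hb
          exact (hl a ha b (h2 b hb.1)).resolve_left hb.2
        have h5 : ∀ b ∈ m.filter (fun b => better a b), Better a b := by
          intro b hb
          simp only [List.mem_filter, better_iff] at hb
          exact hb.2
        refine List.pairwise_append.2 ⟨h3.filter _, List.pairwise_cons.2 ⟨h5, h3.filter _⟩, ?_⟩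
        intro b hb c hc
        rcases List.mem_cons.1 hc with rfl | hc
        · exact h4 b hb
        · exact htrans (h4 b hb) (h5 c hc)
  exact key l [] (fun _ h => h) (by simp) .nil

theorem size_filter_add (f : α → Bool) (l : List α) :
    size (l.filter fun b => !f b) + size (l.filter f) = size l + 1 := by
  induction l with
  | nil => rfl
  | cons a l ih => cases h : f a <;> simp [h, size_cons] <;> omega

@[fun_prop]
theorem Poly.sortVoters {l : α → List (ℕ × ℕ)} (hl : Poly l) : Poly fun a => sortVoters (l a) := by
  unfold PolyTime.sortVoters
  refine Poly.foldl_of_size_le (s := fun _ l a => insertVoter l a) (i := fun _ => []) ?_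
    (by fun_prop) hl (Polynomial.X + 2) fun x b c => ?_
  · unfold insertVoter
    fun_prop
  · have h1 := size_append (b.filter fun d => !PolyTime.better c d)
      (c :: b.filter fun d => PolyTime.better c d)
    have h2 := size_filter_add (fun d => PolyTime.better c d) b
    rw [size_cons] at h1
    simp only [Polynomial.eval_add, Polynomial.eval_X, Polynomial.eval_ofNat]
    unfold insertVoter
    omega

/-! #### The decision function -/

/-- One step of the greedy choice of voters. -/
def greedyStep (k : ℕ) (s : ℕ × ℕ × ℕ) (a : ℕ × ℕ) : ℕ × ℕ × ℕ :=
  bif decide (s.1 + a.1 ≤ k) then (s.1 + a.1, s.2.1 + a.2, s.2.2)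
  else (s.1, s.2.1, s.2.2 + a.2)

/-- The recursion becomes a left fold with accumulators for the money spent and the two weights. -/
theorem greedy_eq (k : ℕ) (l : List (ℕ × ℕ)) (s : ℕ) :
    greedy k l s = (l.foldl (greedyStep k) (s, 0, 0)).2 := by
  have key : ∀ (l : List (ℕ × ℕ)) (s x y : ℕ), (l.foldl (greedyStep k) (s, x, y)).2 =
      (x + (greedy k l s).1, y + (greedy k l s).2) := by
    intro l
    induction l with
    | nil => intro s x y; rfl
    | cons a l ih =>
      intro s x y
      obtain ⟨p, w⟩ := a
      by_cases h : s + p ≤ k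
      · simp [greedyStep, greedy, h, ih, Nat.add_assoc, Nat.add_comm w]
      · simp [greedyStep, greedy, h, ih, Nat.add_assoc, Nat.add_comm w]
  rw [key]; simp

@[fun_prop]
theorem Poly.greedy {k s : α → ℕ} {l : α → List (ℕ × ℕ)} (hk : Poly k) (hl : Poly l) (hs : Poly s) :
    Poly fun a => greedy (k a) (l a) (s a) := by
  simp only [greedy_eq]
  refine Poly.comp (g := fun t : ℕ × ℕ × ℕ => t.2) (by fun_prop) <|
    Poly.foldl_of_size_le (s := fun a t b => greedyStep (k a) t b) (i := fun a => (s a, 0, 0)) ?_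
    -- A step performs at most two additions, each adding at most 5 to the sizes of its summands.
    (by fun_prop) hl (Polynomial.X + 10) fun x b c => ?_
  · have : Poly fun a : α × (ℕ × ℕ × ℕ) × (ℕ × ℕ) => k a.1 := by fun_prop
    unfold greedyStep
    fun_prop
  · obtain ⟨t, x₁, y₁⟩ := b
    obtain ⟨p, w⟩ := c
    have h1 := size_add_le t p
    have h2 := size_add_le x₁ w
    have h3 := size_add_le y₁ w
    simp only [greedyStep, size_pair, Polynomial.eval_add, Polynomial.eval_X,
      Polynomial.eval_ofNat]
    cases decide (t + p ≤ k x) <;> simp only [cond_true, cond_false, size_pair] <;> omega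

/-- A decision function for `Forces`. -/
def forces (v : Version) (C : List ℕ) (σ : Pref) (d k : ℕ) (l : List (ℕ × ℕ)) (spent : ℕ)
    (V : List (Option ℕ × ℕ)) : Bool :=
  C.any fun g => v.good σ d g && C.all fun b => v.good σ d b ||
    decide (topScore V b + ((greedy k l spent).2 + v.lead) ≤ topScore V g + (greedy k l spent).1)

theorem forces_iff (v : Version) (C : List ℕ) (σ : Pref) (d k : ℕ) (l : List (ℕ × ℕ)) (spent : ℕ)
    (V : List (Option ℕ × ℕ)) :
    forces v C σ d k l spent V = true ↔ Forces C (v.good σ d) v.lead k l spent V := by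
  simp only [forces, Forces, Leads, List.any_eq_true, Bool.and_eq_true, List.all_eq_true,
    Bool.or_eq_true, decide_eq_true_eq]
  refine exists_congr fun g => and_congr_right fun _ => and_congr_right fun _ =>
    forall_congr' fun b => forall_congr' fun _ => ?_
  cases v.good σ d b <;> simp

@[fun_prop]
theorem Poly.forces (v : Version) {C σ : α → List ℕ} {d k spent : α → ℕ} {l : α → List (ℕ × ℕ)}
    {V : α → List (Option ℕ × ℕ)} (hC : Poly C) (hσ : Poly σ) (hd : Poly d) (hk : Poly k)
    (hl : Poly l) (hs : Poly spent) (hV : Poly V) :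
    Poly fun a => forces v (C a) (σ a) (d a) (k a) (l a) (spent a) (V a) := by
  unfold PolyTime.forces
  fun_prop

/-- A decision function for `IsPref`. -/
def isPref (C σ : List ℕ) : Bool :=
  (C ++ σ).all fun a => decide ((C.countP fun b => decide (b = a)) = σ.countP fun b => decide (b = a))

theorem isPref_iff {C σ : List ℕ} : isPref C σ = true ↔ IsPref C σ := by
  have hc : ∀ (l : List ℕ) a, (l.countP fun b => decide (b = a)) = l.count a := by
    intro l a
    rw [List.count]
    exact List.countP_congr fun b _ => by simp
  simp only [isPref, IsPref, List.all_eq_true, decide_eq_true_eq, hc]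
  rw [List.perm_iff_count]
  constructor
  · intro h a
    by_cases ha : a ∈ C ++ σ
    · exact (h a ha).symm
    · simp only [List.mem_append, not_or] at ha
      rw [List.count_eq_zero_of_not_mem ha.1, List.count_eq_zero_of_not_mem ha.2]
  · intro h a _
    exact (h a).symm

@[fun_prop]
theorem Poly.isPref {C σ : α → List ℕ} (hC : Poly C) (hσ : Poly σ) :
    Poly fun a => isPref (C a) (σ a) := by
  unfold PolyTime.isPref
  fun_prop

variable {p w : Bool}

/-- A decision function for well-formed settings. -/
def wellFormed (I : OBS p w) : Bool :=
  (I.candidates.all fun a => decide ((I.candidates.countP fun b => decide (b = a)) = 1)) &&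
  ((I.past.all fun v => isPref I.candidates v.vote) && (isPref I.candidates I.current.vote &&
  (isPref I.candidates I.briber && I.candidates.any fun c => decide (c = I.d))))

theorem wellFormed_iff (I : OBS p w) : wellFormed I = true ↔ I.WellFormed := by
  have hc : ∀ a, (I.candidates.countP fun b => decide (b = a)) = I.candidates.count a := by
    intro a
    rw [List.count]
    exact List.countP_congr fun b _ => by simp
  simp only [wellFormed, Bool.and_eq_true, List.all_eq_true, decide_eq_true_eq, hc, isPref_iff,
    List.any_eq_true, exists_eq_right]
  rw [← List.nodup_iff_count_eq_one]
  exact ⟨fun ⟨h1, h2, h3, h4, h5⟩ => ⟨h1, h2, h3, h4, h5⟩,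
    fun ⟨h1, h2, h3, h4, h5⟩ => ⟨h1, h2, h3, h4, h5⟩⟩

@[fun_prop]
theorem Poly.wellFormed : Poly (wellFormed (p := p) (w := w)) := by
  unfold PolyTime.wellFormed
  fun_prop

/-- The prices and weights of the future voters, sorted. -/
def futureData (I : OBS p w) : List (ℕ × ℕ) := sortVoters (I.future.map FutureVoter.data)

/-- The first choices of the votes cast so far. -/
def pastTops (I : OBS p w) : List (Option ℕ × ℕ) :=
  I.past.map fun v => (v.vote.head?, v.weight.value)

/-- A decision function for successful settings. -/
def succeeds (v : Version) (I : OBS p w) : Bool :=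
  decide (I.spent ≤ I.k) &&
  (forces v I.candidates I.briber I.d I.k (futureData I) I.spent
    (pastTops I ++ [(I.current.vote.head?, I.current.weight.value)]) ||
  (decide (I.spent + I.current.price.value ≤ I.k) && I.candidates.any fun t =>
    forces v I.candidates I.briber I.d I.k (futureData I) (I.spent + I.current.price.value)
      (pastTops I ++ [(some t, I.current.weight.value)])))

/-- Here `p = false ∨ w = false` enters: if all prices or all weights are 1, any two voters are
comparable by `Better`. With both varying, a cheap light voter and an expensive heavy one are not.
-/
theorem succeeds_eq_true_iff (h : p = false ∨ w = false) (v : Version) (I : OBS p w)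
    (hI : I.WellFormed) : succeeds v I = true ↔ I.Succeeds plurality v := by
  have htotal : ∀ a ∈ I.future.map FutureVoter.data, ∀ b ∈ I.future.map FutureVoter.data,
      Better a b ∨ Better b a := by
    intro a ha b hb
    obtain ⟨x, -, rfl⟩ := List.mem_map.1 ha
    obtain ⟨y, -, rfl⟩ := List.mem_map.1 hb
    rcases h with rfl | rfl
    · have h1 : ∀ n : OptNat false, n.value = 1 := fun _ => rfl
      simp only [Better, FutureVoter.data, h1]
      omega
    · have h1 : ∀ n : OptNat false, n.value = 1 := fun _ => rfl
      simp only [Better, FutureVoter.data, h1]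
      omega
  have hV : I.castVotes.map WeightedVote.top = pastTops I := by
    unfold OBS.castVotes pastTops
    rw [List.map_map]; rfl
  rw [succeeds_iff I hI v (sortVoters_perm _) (sortVoters_pairwise htotal), hV]
  simp only [succeeds, Bool.and_eq_true, Bool.or_eq_true, decide_eq_true_eq, List.any_eq_true,
    forces_iff, futureData]

@[fun_prop]
theorem Poly.futureData : Poly (futureData (p := p) (w := w)) := by
  unfold PolyTime.futureData FutureVoter.data
  fun_prop

@[fun_prop]
theorem Poly.pastTops : Poly (pastTops (p := p) (w := w)) := by
  unfold PolyTime.pastTops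
  fun_prop

@[fun_prop]
theorem Poly.spent : Poly (OBS.spent (p := p) (w := w)) := by
  have : Poly fun I : OBS p w =>
      (I.past.map fun v => bif v.bribed then v.price.value else 0).sum := by fun_prop
  simp only [cond_eq_ite] at this
  exact this

theorem Poly.succeeds (v : Version) : Poly (succeeds (p := p) (w := w) v) := by
  unfold PolyTime.succeeds
  fun_prop

theorem inP_onlineBribery_plurality (h : p = false ∨ w = false) (v : Version) :
    InP (onlineBribery plurality v p w) := by
  have hs := Poly.succeeds (p := p) (w := w) v
  have := inP_of_poly_obs (p := p) (w := w) (fun I => I.WellFormed ∧ I.Succeeds plurality v)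
    (fun I => wellFormed I && succeeds v I) (by fun_prop) fun I => by
      rw [Bool.and_eq_true, wellFormed_iff]
      exact and_congr_right fun hI => succeeds_eq_true_iff h v I hI
  simp only [and_assoc] at this
  exact this

end PolyTime

theorem mainTheorem9 :
    InP (Election.onlineBribery Election.plurality .constructive
      (priced := false) (weighted := false)) ∧
    InP (Election.onlineBribery Election.plurality .destructive
      (priced := false) (weighted := false)) ∧
    InP (Election.onlineBribery Election.plurality .constructive
      (priced := false) (weighted := true)) ∧
    InP (Election.onlineBribery Election.plurality .destructive
      (priced := false) (weighted := true)) ∧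
    InP (Election.onlineBribery Election.plurality .constructive
      (priced := true) (weighted := false)) ∧
    InP (Election.onlineBribery Election.plurality .destructive
      (priced := true) (weighted := false)) :=
  ⟨PolyTime.inP_onlineBribery_plurality (.inl rfl) _,
    PolyTime.inP_onlineBribery_plurality (.inl rfl) _,
    PolyTime.inP_onlineBribery_plurality (.inl rfl) _,
    PolyTime.inP_onlineBribery_plurality (.inl rfl) _,
    PolyTime.inP_onlineBribery_plurality (.inr rfl) _,
    PolyTime.inP_onlineBribery_plurality (.inr rfl) _⟩
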